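/- Let $G$ be a locally compact (Hausdorff) group with left Haar measure $dx$ and $\mathfrak A$ a $C^*$-algebra with multiplier algebra $\mathcal M(\mathfrak A)$. Let $(G,\alpha,\omega,\mathfrak A)$ be a twisted action: that is, $\alpha:G\to\mathrm{Aut}(\mathfrak A)$ is a map into the $*$-automorphisms with $x\mapsto\alpha_x(a)$ norm continuous for every $a\in\mathfrak A$, and $\omega:G\times G\to\mathcal{UM}(\mathfrak A)$ is a strictly continuous map into the unitary multipliers, such that for all $x,y,z\in G$ and $a\in\mathfrak A$ $$\alpha_x(\omega(y,z))\,\omega(x,yz)=\omega(x,y)\,\omega(xy,z),\qquad \alpha_x(\alpha_y(a))\,\omega(x,y)=\omega(x,y)\,\alpha_{xy}(a),$$ $$\omega(x,e)=\omega(e,y)=1,\qquad \alpha_e=\mathrm{id}_{\mathfrak A}.$$ Let $\mathcal B=L^1_{\alpha,\omega}(G,\mathfrak A)$ be the Banach algebra of (classes of) Bochner integrable functions $\Phi:G\to\mathfrak A$ with the norm $\|\Phi\|=\int_G\|\Phi(x)\|\,dx$ and the twisted convolution product $$\Phi*\Psi(x)=\int_G\Phi(y)\,\alpha_y[\Psi(y^{-1}x)]\,\omega(y,y^{-1}x)\,dy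 .$$ This product is well defined: for all $\Phi,\Psi\in\mathcal B$ the integrand is Bochner integrable for almost every $x$, and $\Phi*\Psi$ is Bochner integrable. Moreover, the following conditions are equivalent: (i) every algebra homomorphism from $\mathcal B$ into a Banach algebra with finite-dimensional range is continuous; (ii) every derivation from $\mathcal B$ into a finite-dimensional Banach $\mathcal B$-bimodule (one whose left and right actions are jointly continuous) is continuous, where a derivation is a linear map $D$ with $D(ab)=D(a)b+aD(b)$; (iii) every two-sided ideal of $\mathcal B$ of finite codimension is closed; (iv) for every closed two-sided ideal $I$ of $\mathcal B$ of finite codimension, $I^2$ (the linear span of the products of two elements of $I$) is closed and of finite codimension. -/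

import Mathlib

open MeasureTheory
open scoped MultiplierAlgebra

universe u v w

noncomputable section

/-- A `*`-automorphism of a C⋆-algebra as a bounded operator. -/
def automorphismCLM {A : Type v} [NonUnitalCStarAlgebra A] (σ : A ≃⋆ₐ[ℂ] A) : A →L[ℂ] A where
  toFun := σ
  map_add' := map_add σ
  map_smul' := map_smul σ
  cont := (StarAlgEquiv.isometry σ).continuous

/-- The canonical extension of a `*`-automorphism `σ` of a C⋆-algebra to its multiplier algebra:
`σ(u) a = σ (u (σ⁻¹ a))` and `a σ(u) = σ ((σ⁻¹ a) u)`. -/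
def multiplierExtend {A : Type v} [NonUnitalCStarAlgebra A] (σ : A ≃⋆ₐ[ℂ] A) (u : 𝓜(ℂ, A)) :
    𝓜(ℂ, A) where
  fst := ((automorphismCLM σ).comp u.fst).comp (automorphismCLM σ.symm)
  snd := ((automorphismCLM σ).comp u.snd).comp (automorphismCLM σ.symm)
  central := fun x y => by
    have h := congrArg σ (u.central (σ.symm x) (σ.symm y))
    simpa [automorphismCLM] using h

/-- A (continuous) twisted action `(G, α, ω, A)` of a topological group `G` on a C⋆-algebra `A`.
The group of `*`-automorphisms carries the topology of pointwise norm convergence and the unitary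
group of the multiplier algebra carries the strict topology. -/
structure TwistedAction (G : Type u) (A : Type v) [Group G] [TopologicalSpace G]
    [NonUnitalCStarAlgebra A] where
  /-- the action by `*`-automorphisms -/
  α : G → (A ≃⋆ₐ[ℂ] A)
  /-- the `2`-cocycle with values in the unitary multipliers -/
  ω : G → G → unitary 𝓜(ℂ, A)
  continuous_α : ∀ a : A, Continuous fun x : G => α x a
  continuous_ω_left : ∀ a : A, Continuous fun p : G × G => (ω p.1 p.2 : 𝓜(ℂ, A)).fst a
  continuous_ω_right : ∀ a : A, Continuous fun p : G × G => (ω p.1 p.2 : 𝓜(ℂ, A)).snd a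
  cocycle : ∀ x y z : G, multiplierExtend (α x) (ω y z : 𝓜(ℂ, A)) * (ω x (y * z) : 𝓜(ℂ, A)) =
    (ω x y : 𝓜(ℂ, A)) * (ω (x * y) z : 𝓜(ℂ, A))
  twist : ∀ (x y : G) (a : A), ((α x (α y a) : A) : 𝓜(ℂ, A)) * (ω x y : 𝓜(ℂ, A)) =
    (ω x y : 𝓜(ℂ, A)) * ((α (x * y) a : A) : 𝓜(ℂ, A))
  ω_one_right : ∀ x : G, ω x 1 = 1
  ω_one_left : ∀ y : G, ω 1 y = 1
  α_one : ∀ a : A, α 1 a = a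

namespace TwistedAction

variable {G : Type u} {A : Type v} [Group G] [TopologicalSpace G] [NonUnitalCStarAlgebra A]

/-- The integrand `y ↦ Φ(y) α_y[Ψ(y⁻¹x)] ω(y, y⁻¹x)` of the twisted convolution at `x`
(right multiplication of an element `a` of `A` by a multiplier `u` is `u.snd a`). -/
def convIntegrand (T : TwistedAction G A) (Φ Ψ : G → A) (x y : G) : A :=
  (T.ω y (y⁻¹ * x) : 𝓜(ℂ, A)).snd (Φ y * T.α y (Ψ (y⁻¹ * x)))

/-- The twisted convolution `(Φ * Ψ)(x) = ∫ Φ(y) α_y[Ψ(y⁻¹x)] ω(y, y⁻¹x) dy`. -/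
def conv [MeasurableSpace G] (T : TwistedAction G A) (μ : Measure G) (Φ Ψ : G → A) (x : G) : A :=
  ∫ y, T.convIntegrand Φ Ψ x y ∂μ

/-- The Banach space `L¹(G, A)` of (classes of) Bochner integrable functions, as the carrier of
the twisted convolution algebra. -/
def L1 [MeasurableSpace G] (_T : TwistedAction G A) (μ : Measure G) : Type (max u v) :=
  Lp A 1 μ

variable [MeasurableSpace G] (T : TwistedAction G A) (μ : Measure G)

instance : NormedAddCommGroup (T.L1 μ) := inferInstanceAs (NormedAddCommGroup (Lp A 1 μ))

instance : NormedSpace ℂ (T.L1 μ) := inferInstanceAs (NormedSpace ℂ (Lp A 1 μ))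

instance : CompleteSpace (T.L1 μ) := inferInstanceAs (CompleteSpace (Lp A 1 μ))

variable {T μ} in
/-- A function `G → A` representing an element of `L¹(G, A)`. -/
def L1.toFun (Φ : T.L1 μ) : G → A :=
  AEEqFun.cast (Subtype.val (p := fun f : G →ₘ[μ] A => f ∈ Lp A 1 μ) Φ)

open scoped Classical in
/-- Twisted convolution as the product of `L¹(G, A)`. The value `0` in the second case is
never used when `μ` is a Haar measure of a locally compact group. -/
instance : Mul (T.L1 μ) where
  mul Φ Ψ := if h : Integrable (T.conv μ Φ.toFun Ψ.toFun) μ then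
      (h.toL1 (T.conv μ Φ.toFun Ψ.toFun) : Lp A 1 μ)
    else (0 : Lp A 1 μ)

end TwistedAction

section Algebra

variable (B : Type u) [NormedAddCommGroup B] [NormedSpace ℂ B] [Mul B]

/-- A Banach `B`-bimodule structure on a normed space `X` over a Banach algebra `B`: commuting
bilinear left and right actions that are jointly continuous. -/
structure BanachBimodule (X : Type w) [NormedAddCommGroup X] [NormedSpace ℂ X] where
  /-- the left action `b ξ` -/
  left : B →ₗ[ℂ] X →ₗ[ℂ] X
  /-- the right action `ξ b`, written `right b ξ` -/
  right : B →ₗ[ℂ] X →ₗ[ℂ] X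
  left_mul : ∀ (a b : B) (ξ : X), left (a * b) ξ = left a (left b ξ)
  right_mul : ∀ (a b : B) (ξ : X), right (a * b) ξ = right b (right a ξ)
  left_right : ∀ (a b : B) (ξ : X), left a (right b ξ) = right b (left a ξ)
  continuous_left : Continuous fun p : B × X => left p.1 p.2
  continuous_right : Continuous fun p : B × X => right p.1 p.2

/-- A derivation `D : B → X`, that is `D(ab) = D(a) b + a D(b)`. -/
def BanachBimodule.IsDerivation {B : Type u} [NormedAddCommGroup B] [NormedSpace ℂ B] [Mul B]
    {X : Type w} [NormedAddCommGroup X] [NormedSpace ℂ X] (M : BanachBimodule B X)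
    (D : B →ₗ[ℂ] X) : Prop :=
  ∀ a b : B, D (a * b) = M.right b (D a) + M.left a (D b)

/-- A linear subspace that is a two-sided ideal. -/
def IsTwoSidedIdeal {B : Type u} [NormedAddCommGroup B] [NormedSpace ℂ B] [Mul B]
    (I : Submodule ℂ B) : Prop :=
  ∀ a : B, ∀ b ∈ I, a * b ∈ I ∧ b * a ∈ I

/-- Finite codimension. -/
def IsCofinite {B : Type u} [NormedAddCommGroup B] [NormedSpace ℂ B] (I : Submodule ℂ B) : Prop :=
  FiniteDimensional ℂ (B ⧸ I)

/-- `I²`, the linear span of the products of two elements of `I`. -/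
def idealSq {B : Type u} [NormedAddCommGroup B] [NormedSpace ℂ B] [Mul B]
    (I : Submodule ℂ B) : Submodule ℂ B :=
  Submodule.span ℂ {c | ∃ a ∈ I, ∃ b ∈ I, c = a * b}

/-- Each homomorphism from `B` into a Banach algebra with finite-dimensional range is
continuous. -/
def FiniteRangeHomsContinuous : Prop :=
  ∀ (C : Type w) [NonUnitalNormedRing C] [NormedSpace ℂ C] [IsScalarTower ℂ C C]
    [SMulCommClass ℂ C C] [CompleteSpace C] (φ : B →ₗ[ℂ] C),
    (∀ a b : B, φ (a * b) = φ a * φ b) → FiniteDimensional ℂ (LinearMap.range φ) → Continuous φ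

/-- Every derivation from `B` into a finite-dimensional Banach `B`-bimodule is continuous. -/
def FiniteDimDerivationsContinuous : Prop :=
  ∀ (X : Type w) [NormedAddCommGroup X] [NormedSpace ℂ X] [FiniteDimensional ℂ X]
    (M : BanachBimodule B X) (D : B →ₗ[ℂ] X), M.IsDerivation D → Continuous D

/-- Every cofinite two-sided ideal of `B` is closed. -/
def CofiniteIdealsClosed : Prop :=
  ∀ I : Submodule ℂ B, IsTwoSidedIdeal I → IsCofinite I → IsClosed (I : Set B)

/-- `I²` is closed and cofinite for every closed cofinite two-sided ideal `I` of `B`. -/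
def SquaresClosedCofinite : Prop :=
  ∀ I : Submodule ℂ B, IsTwoSidedIdeal I → IsClosed (I : Set B) → IsCofinite I →
    IsClosed (idealSq I : Set B) ∧ IsCofinite (idealSq I)

end Algebra

end

/-! The heart is (ii) ⇒ (iv); the other implications use only general Banach algebra arguments.
Condition (iii) gives (i) and (ii) because a linear map killing a closed cofinite ideal factors
through a finite-dimensional space, and (i) gives (iii) because a cofinite ideal `J` is the kernel
of the action of `B` on its unitization modulo `J`. For (iv) ⇒ (iii), the iterated squares of the
closure of `J` are closed and cofinite, and their images in `B ⧸ J` stabilise, so one of them, `L`,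
satisfies `L ≤ L² + J`. A Nakayama argument, powered by a Neumann series because `J` is dense in its
closure, gives `L ≤ J`, and `J` is closed.

For (ii) ⇒ (iv) it suffices that each functional `f` killing `I²` is continuous, hence that the
largest ideal `J` inside `I ∩ ker f` is closed; it is cofinite and `I² ≤ J ≤ I`. The obstruction to
extending the quotient map `I → I/J` to a derivation `D` on `B` is the class of the square-zero
extension `0 → I/J → B/J → B/I → 0` in second Hochschild cohomology. It vanishes by averaging over a
compact group spanning `B/I` (`BanachBimodule.exists_isDerivation`). Then `D` is continuous by (ii)
and `J = I ∩ ker D` is closed (`isClosed_of_idealSq_le`).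

The compact group comes from the twisted action. The isometries `f ↦ v L_y f`, with `v` a unitary
multiplier and `L_y` the twisted translation, commute with right multiplication, and approximate
units make them act on `B/I` as left multiplications by elements of `B`. Since `f * g = ∫ f(y) L_y g
dy` and the unitaries span the multiplier algebra, `f * g` lies in the closed span of the `v L_y g`.

Haar measure need not be σ-finite, so Fubini is not available for arbitrary integrable functions.
The product is built as a Bochner integral in `L¹` (`convL1`) and matched with the pointwise formula
by expanding both factors in series of continuous compactly supported functions (`conv_ae_eq`). -/

set_option linter.unusedSectionVars false

/-! ### Cofinite ideals in a Banach algebra: (i), (ii), (iii) and Nakayama -/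

section CofiniteIdeals

variable {B : Type u} [NonUnitalNormedRing B] [NormedSpace ℂ B]

lemma IsCofinite.mono {I J : Submodule ℂ B} (hI : IsCofinite I) (h : I ≤ J) : IsCofinite J := by
  have : FiniteDimensional ℂ (B ⧸ I) := hI
  exact Module.Finite.of_surjective (Submodule.factor h) (Submodule.factor_surjective h)

lemma isCofinite_ker_of_finiteDimensional_range {X : Type*} [AddCommGroup X] [Module ℂ X]
    (f : B →ₗ[ℂ] X) [FiniteDimensional ℂ (LinearMap.range f)] : IsCofinite (LinearMap.ker f) :=
  Module.Finite.equiv f.quotKerEquivRange.symm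

lemma isCofinite_ker {X : Type*} [AddCommGroup X] [Module ℂ X] [FiniteDimensional ℂ X]
    (f : B →ₗ[ℂ] X) : IsCofinite (LinearMap.ker f) :=
  isCofinite_ker_of_finiteDimensional_range f

lemma IsCofinite.inf {I J : Submodule ℂ B} (hI : IsCofinite I) (hJ : IsCofinite J) :
    IsCofinite (I ⊓ J) := by
  have : FiniteDimensional ℂ (B ⧸ I) := hI
  have : FiniteDimensional ℂ (B ⧸ J) := hJ
  have h := isCofinite_ker (I.mkQ.prod J.mkQ)
  rwa [LinearMap.ker_prod, Submodule.ker_mkQ, Submodule.ker_mkQ] at h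

/-- Closedness of `I` makes the finite-dimensional quotient Hausdorff, and every linear map out of
it is then continuous. -/
lemma continuous_of_cofinite_le_ker {X : Type*} [AddCommGroup X] [Module ℂ X] [TopologicalSpace X]
    [IsTopologicalAddGroup X] [ContinuousSMul ℂ X] {I : Submodule ℂ B} (hc : IsClosed (I : Set B))
    (hI : IsCofinite I) (f : B →ₗ[ℂ] X) (h : I ≤ LinearMap.ker f) : Continuous f := by
  have : FiniteDimensional ℂ (B ⧸ I) := hI
  have : IsClosed (I : Set B) := hc
  have h1 : Continuous (I.liftQ f h) := LinearMap.continuous_of_finiteDimensional _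
  exact h1.comp (Submodule.mkQL I).continuous

lemma isClosed_of_cofinite_le {I J : Submodule ℂ B} (hc : IsClosed (I : Set B))
    (hI : IsCofinite I) (h : I ≤ J) : IsClosed (J : Set B) := by
  have : FiniteDimensional ℂ (B ⧸ I) := hI
  have : IsClosed (I : Set B) := hc
  have h2 : (J : Set B) = I.mkQL ⁻¹' (J.map I.mkQ : Submodule ℂ (B ⧸ I)) := by
    ext x
    have : J = (J.map I.mkQ).comap I.mkQ := by
      rw [Submodule.comap_map_eq, Submodule.ker_mkQ, sup_eq_left.2 h]
    exact (SetLike.ext_iff.1 this x)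
  rw [h2]
  exact (Submodule.closed_of_finiteDimensional _).preimage I.mkQL.continuous

lemma finiteRangeHomsContinuous_of_cofiniteIdealsClosed (h : CofiniteIdealsClosed B) :
    FiniteRangeHomsContinuous.{u, w} B := by
  intro C _ _ _ _ _ φ hφ hfin
  have hcof := isCofinite_ker_of_finiteDimensional_range φ
  refine continuous_of_cofinite_le_ker (h _ ?_ hcof) hcof φ le_rfl
  intro a b hb
  rw [LinearMap.mem_ker] at hb
  simp [LinearMap.mem_ker, hφ, hb]

/-- The kernel of `D` alone need not be an ideal. Intersecting it with the annihilators of both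
actions kills each term of the Leibniz rule, and the result stays cofinite because `X` is
finite-dimensional. -/
lemma finiteDimDerivationsContinuous_of_cofiniteIdealsClosed (h : CofiniteIdealsClosed B) :
    FiniteDimDerivationsContinuous.{u, w} B := by
  intro X _ _ _ M D hD
  have hcof : IsCofinite (LinearMap.ker D ⊓ (LinearMap.ker M.left ⊓ LinearMap.ker M.right)) :=
    (isCofinite_ker D).inf ((isCofinite_ker M.left).inf (isCofinite_ker M.right))
  refine continuous_of_cofinite_le_ker (h _ ?_ hcof) hcof D inf_le_left
  rintro a b ⟨hb1, hb2, hb3⟩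
  simp only [SetLike.mem_coe, LinearMap.mem_ker] at hb1 hb2 hb3
  simp only [Submodule.mem_inf, LinearMap.mem_ker, hD a b, hD b a, hb1, hb2, hb3]
  refine ⟨⟨by simp, LinearMap.ext fun ξ => by simp [M.left_mul, hb2],
    LinearMap.ext fun ξ => by simp [M.right_mul, hb3]⟩, by simp,
    LinearMap.ext fun ξ => by simp [M.left_mul, hb2],
    LinearMap.ext fun ξ => by simp [M.right_mul, hb3]⟩

variable [IsScalarTower ℂ B B] [SMulCommClass ℂ B B]

/-- Left multiplication on the quotient by an ideal. -/
def quotientMulLeft (J : Submodule ℂ B) (hJ : IsTwoSidedIdeal J) (b : B) : (B ⧸ J) →ₗ[ℂ] (B ⧸ J) :=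
  J.mapQ J (LinearMap.mulLeft ℂ b) fun x hx => (hJ b x hx).1

@[simp]
lemma quotientMulLeft_mk (J : Submodule ℂ B) (hJ : IsTwoSidedIdeal J) (b x : B) :
    quotientMulLeft J hJ b (Submodule.Quotient.mk x) = Submodule.Quotient.mk (b * x) := rfl

/-- The representation of `B` on `(B ⧸ J) × ℂ` by left multiplication on the unitization. -/
def unitizationQuotientRep (J : Submodule ℂ B) (hJ : IsTwoSidedIdeal J) :
    B →ₗ[ℂ] Module.End ℂ ((B ⧸ J) × ℂ) where
  toFun b := LinearMap.prod
    ((quotientMulLeft J hJ b).comp (LinearMap.fst ℂ _ _) +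
      (LinearMap.toSpanSingleton ℂ _ (J.mkQ b)).comp (LinearMap.snd ℂ _ _)) 0
  map_add' a b := by
    refine LinearMap.ext fun ⟨x, t⟩ => ?_
    obtain ⟨x, rfl⟩ := J.mkQ_surjective x
    simp [add_mul]
    abel
  map_smul' c b := by
    refine LinearMap.ext fun ⟨x, t⟩ => ?_
    obtain ⟨x, rfl⟩ := J.mkQ_surjective x
    simp only [LinearMap.prod_apply, Function.prod_apply]
    simp [smul_comm t c]
    rw [smul_mul_assoc]
    rfl

/-- The action on `B ⧸ J` itself could have a kernel larger than `J`. With a unit adjoined, `b`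
sends the unit to its own class, so the kernel is exactly `J`. -/
lemma finiteRangeHoms_to_cofiniteIdealsClosed (h : FiniteRangeHomsContinuous.{u, w} B) :
    CofiniteIdealsClosed B := by
  intro J hJ hcof
  have : FiniteDimensional ℂ (B ⧸ J) := hcof
  -- The target algebra must live in the universe `w` and carry a norm, so the representation space
  -- is replaced by a lifted coordinate space.
  let W := ULift.{w} (Fin (Module.finrank ℂ ((B ⧸ J) × ℂ)) → ℂ)
  let e : ((B ⧸ J) × ℂ) ≃ₗ[ℂ] W := (Module.finBasis ℂ ((B ⧸ J) × ℂ)).equivFun.trans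
    ULift.moduleEquiv.symm
  let φ : B →ₗ[ℂ] (W →L[ℂ] W) := (LinearMap.toContinuousLinearMap : (W →ₗ[ℂ] W) ≃ₗ[ℂ] _).toLinearMap ∘ₗ
    (e.conj : Module.End ℂ ((B ⧸ J) × ℂ) ≃ₗ[ℂ] Module.End ℂ W).toLinearMap ∘ₗ
      unitizationQuotientRep J hJ
  have hmul : ∀ a b, φ (a * b) = φ a * φ b := by
    intro a b
    have h1 : unitizationQuotientRep J hJ (a * b) =
        unitizationQuotientRep J hJ a * unitizationQuotientRep J hJ b := by
      refine LinearMap.ext fun ⟨x, t⟩ => ?_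
      obtain ⟨x, rfl⟩ := J.mkQ_surjective x
      simp [unitizationQuotientRep, mul_assoc]
    ext1 x
    simp [φ, h1, LinearEquiv.conj_apply]
  have : IsScalarTower ℂ (W →L[ℂ] W) (W →L[ℂ] W) := ⟨fun c x y => by ext1; simp⟩
  have : SMulCommClass ℂ (W →L[ℂ] W) (W →L[ℂ] W) := ⟨fun c x y => by ext1; simp⟩
  have hφ := h (W →L[ℂ] W) φ hmul inferInstance
  have hker : (J : Set B) = φ ⁻¹' {0} := by
    ext b
    simp only [SetLike.mem_coe, Set.mem_preimage, Set.mem_singleton_iff, φ, LinearMap.comp_apply,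
      LinearEquiv.coe_coe, LinearEquiv.map_eq_zero_iff]
    constructor
    · intro hb
      refine LinearMap.ext fun ⟨x, t⟩ => ?_
      obtain ⟨x, rfl⟩ := J.mkQ_surjective x
      simp [unitizationQuotientRep, (Submodule.Quotient.mk_eq_zero J).2 (hJ x b hb).2,
        (Submodule.Quotient.mk_eq_zero J).2 hb]
    · intro hb
      have := congrArg Prod.fst (LinearMap.congr_fun hb (0, 1))
      simpa [unitizationQuotientRep] using this
  rw [hker]
  exact isClosed_singleton.preimage hφ

/-- The Neumann series without a unit: formally `1 + w = (1 - v)⁻¹`. Inverting `1 - R`, with `R`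
right multiplication by `v`, produces the solution of `w - w v = v`. -/
lemma exists_mul_sub_eq_of_norm_lt_one [CompleteSpace B] {v : B} (hv : ‖v‖ < 1) : ∃ w : B, ∀ x : B,
    x = (x - v * x) + w * (x - v * x) := by
  let R : B →L[ℂ] B := (ContinuousLinearMap.mul ℂ B).flip v
  have hR : ‖R‖ < 1 := by
    refine lt_of_le_of_lt (ContinuousLinearMap.opNorm_le_bound _ (norm_nonneg v) fun x => ?_) hv
    rw [mul_comm]
    exact norm_mul_le x v
  have hu := (Units.oneSub R hR).mul_inv
  refine ⟨(↑(Units.oneSub R hR)⁻¹ : B →L[ℂ] B) v, fun x => ?_⟩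
  set w := (↑(Units.oneSub R hR)⁻¹ : B →L[ℂ] B) v
  have hw : w - w * v = v := by
    have := DFunLike.congr_fun hu v
    simpa [R] using this
  have : w * x - w * v * x = v * x := by rw [← sub_mul, hw]
  rw [mul_sub, ← mul_assoc, this]
  abel

lemma idealSq_le {I : Submodule ℂ B} (hI : IsTwoSidedIdeal I) : idealSq I ≤ I := by
  refine Submodule.span_le.2 ?_
  rintro _ ⟨a, _, b, hb, rfl⟩
  exact (hI a b hb).1

lemma isTwoSidedIdeal_idealSq {I : Submodule ℂ B} (hI : IsTwoSidedIdeal I) :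
    IsTwoSidedIdeal (idealSq I) := by
  intro a b hb
  constructor
  · have : idealSq I ≤ (idealSq I).comap (LinearMap.mulLeft ℂ a) := by
      refine Submodule.span_le.2 ?_
      rintro _ ⟨x, hx, y, hy, rfl⟩
      exact Submodule.subset_span ⟨a * x, (hI a x hx).1, y, hy, (mul_assoc a x y).symm⟩
    exact this hb
  · have : idealSq I ≤ (idealSq I).comap (LinearMap.mulRight ℂ a) := by
      refine Submodule.span_le.2 ?_
      rintro _ ⟨x, hx, y, hy, rfl⟩
      exact Submodule.subset_span ⟨x, hx, y * a, (hI a y hy).2, mul_assoc x y a⟩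
    exact this hb

lemma isTwoSidedIdeal_topologicalClosure {I : Submodule ℂ B} (hI : IsTwoSidedIdeal I) :
    IsTwoSidedIdeal I.topologicalClosure := by
  intro a b hb
  constructor
  · exact map_mem_closure (f := fun b => a * b) (by fun_prop) hb fun x hx => (hI a x hx).1
  · exact map_mem_closure (f := fun b => b * a) (by fun_prop) hb fun x hx => (hI a x hx).2

/-- A Nakayama lemma: an ideal contained in the closure of `J` which is generated modulo `J` by
finitely many elements with coefficients in itself is contained in `J`. -/
lemma le_of_le_span_mul_sup [CompleteSpace B] {J L : Submodule ℂ B} (hJ : IsTwoSidedIdeal J) (hL : IsTwoSidedIdeal L)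
    (hLJ : L ≤ J.topologicalClosure) (s : List B) (hs : ∀ m ∈ s, m ∈ L)
    (h : L ≤ (s.map fun m => L.map (LinearMap.mulRight ℂ m)).sum ⊔ J) : L ≤ J := by
  induction s with
  | nil => simpa using h
  | cons m s ih =>
    refine ih (fun x hx => hs x (List.mem_cons_of_mem m hx)) ?_
    set Y := (s.map fun m => L.map (LinearMap.mulRight ℂ m)).sum ⊔ J with hY
    have hideal : ∀ (s : List B) (a : B), ∀ y ∈ (s.map fun m => L.map (LinearMap.mulRight ℂ m)).sum,
        a * y ∈ (s.map fun m => L.map (LinearMap.mulRight ℂ m)).sum := by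
      intro s a
      induction s with
      | nil => simp
      | cons m s ih =>
        intro y hy
        simp only [List.map_cons, List.sum_cons, Submodule.add_eq_sup] at hy ⊢
        obtain ⟨_, ⟨l, hl, rfl⟩, z, hz, rfl⟩ := Submodule.mem_sup.1 hy
        rw [mul_add]
        refine Submodule.add_mem_sup ⟨a * l, (hL a l hl).1, ?_⟩ (ih z hz)
        simp [mul_assoc]
    have hYl : ∀ a : B, ∀ y ∈ Y, a * y ∈ Y := by
      intro a y hy
      obtain ⟨p, hp, j, hj, rfl⟩ := Submodule.mem_sup.1 hy
      rw [mul_add]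
      exact Submodule.add_mem_sup (hideal s a p hp) (hJ a j hj).1
    have h' : L ≤ L.map (LinearMap.mulRight ℂ m) ⊔ Y := by
      simpa [hY, sup_assoc] using h
    -- Write `m = l m + y` and choose `j ∈ J` with `‖l - j‖ < 1`. Then `(1 - (l - j)) m = y + j m`
    -- lies in the left ideal `Y`, and inverting the factor puts `m` in `Y`. Hence `L m ≤ Y`, and
    -- the generator `m` can be dropped.
    have hm : m ∈ Y := by
      obtain ⟨_, ⟨l, hl, rfl⟩, y, hy, hly⟩ := Submodule.mem_sup.1 (h' (hs m List.mem_cons_self))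
      obtain ⟨j, hj, hlj⟩ := Metric.mem_closure_iff.1 (hLJ hl) 1 one_pos
      rw [dist_eq_norm] at hlj
      obtain ⟨w, hw⟩ := exists_mul_sub_eq_of_norm_lt_one hlj
      have h1 : m - (l - j) * m ∈ Y := by
        have : m - (l - j) * m = y + j * m := by
          have : y = m - l * m := by rw [eq_sub_iff_add_eq', ← LinearMap.mulRight_apply (R := ℂ), hly]
          rw [this, sub_mul]; abel
        rw [this]
        exact Y.add_mem hy (Submodule.mem_sup_right (hJ m j hj).2)
      rw [hw m]
      exact Y.add_mem h1 (hYl w _ h1)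
    refine h'.trans (sup_le ?_ le_rfl)
    rintro _ ⟨l, _, rfl⟩
    exact hYl l m hm

/-- Finite codimension of `J` provides the generators for the Nakayama lemma: lifts to `L` of a
finite spanning set of the image of `L` in `B ⧸ J`. -/
lemma le_of_le_idealSq_sup [CompleteSpace B] {J L : Submodule ℂ B} (hJ : IsTwoSidedIdeal J) (hcof : IsCofinite J)
    (hL : IsTwoSidedIdeal L) (hLJ : L ≤ J.topologicalClosure) (h : L ≤ idealSq L ⊔ J) : L ≤ J := by
  have : FiniteDimensional ℂ (B ⧸ J) := hcof
  have hfg : (L.map J.mkQ).FG := IsNoetherian.noetherian _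
  obtain ⟨s, hs⟩ := hfg
  have hsL : ∀ x ∈ s, ∃ m ∈ L, J.mkQ m = x := fun x hx => by
    have : x ∈ L.map J.mkQ := hs ▸ Submodule.subset_span hx
    simpa using this
  choose! g hgL hg using hsL
  refine le_of_le_span_mul_sup hJ hL hLJ (s.toList.map g) ?_ ?_
  · simp only [List.mem_map, Finset.mem_toList]
    rintro _ ⟨x, hx, rfl⟩
    exact hgL x hx
  · refine h.trans (sup_le (Submodule.span_le.2 ?_) le_sup_right)
    rintro _ ⟨a, ha, b, hb, rfl⟩
    have hb' : J.mkQ b ∈ Submodule.span ℂ (s : Set (B ⧸ J)) := hs ▸ ⟨b, hb, rfl⟩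
    have hb2 : b ∈ Submodule.span ℂ (g '' s) ⊔ J := by
      have : Submodule.span ℂ (s : Set (B ⧸ J)) = (Submodule.span ℂ (g '' s)).map J.mkQ := by
        rw [Submodule.map_span, Set.image_image]
        congr 1
        ext x
        constructor
        · intro hx; exact ⟨x, hx, hg x hx⟩
        · rintro ⟨y, hy, rfl⟩; simpa only [hg y hy] using hy
      rw [this] at hb'
      have h3 : b ∈ ((Submodule.span ℂ (g '' s)).map J.mkQ).comap J.mkQ := hb'
      rwa [Submodule.comap_map_eq, Submodule.ker_mkQ] at h3
    obtain ⟨p, hp, j, hj, rfl⟩ := Submodule.mem_sup.1 hb2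
    rw [mul_add]
    refine Submodule.add_mem_sup ?_ (hJ a j hj).1
    have : Submodule.span ℂ (g '' s) ≤
        (((s.toList.map g).map fun m => L.map (LinearMap.mulRight ℂ m)).sum).comap
          (LinearMap.mulLeft ℂ a) := by
      refine Submodule.span_le.2 ?_
      rintro _ ⟨x, hx, rfl⟩
      have hmem : L.map (LinearMap.mulRight ℂ (g x)) ∈
          (s.toList.map g).map fun m => L.map (LinearMap.mulRight ℂ m) :=
        List.mem_map_of_mem (List.mem_map_of_mem (Finset.mem_toList.2 hx))
      exact List.single_le_sum (fun _ _ => bot_le) _ hmem ⟨a, ha, rfl⟩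
    exact this hp

lemma cofiniteIdealsClosed_of_squaresClosedCofinite [CompleteSpace B] (h : SquaresClosedCofinite B) :
    CofiniteIdealsClosed B := by
  intro J hJ hcof
  have : FiniteDimensional ℂ (B ⧸ J) := hcof
  let K : ℕ → Submodule ℂ B := fun n => (idealSq)^[n] J.topologicalClosure
  have hK : ∀ n, IsTwoSidedIdeal (K n) ∧ IsClosed (K n : Set B) ∧ IsCofinite (K n) ∧
      K n ≤ J.topologicalClosure := by
    intro n
    induction n with
    | zero => exact ⟨isTwoSidedIdeal_topologicalClosure hJ, J.isClosed_topologicalClosure,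
        hcof.mono J.le_topologicalClosure, le_rfl⟩
    | succ n ih =>
      simp only [K, Function.iterate_succ_apply'] at ih ⊢
      obtain ⟨h1, h2, h3, h4⟩ := ih
      obtain ⟨h5, h6⟩ := h _ h1 h2 h3
      exact ⟨isTwoSidedIdeal_idealSq h1, h5, h6, (idealSq_le h1).trans h4⟩
  -- The images of the iterated squares decrease in the finite-dimensional `B ⧸ J`, hence stabilise.
  -- At that stage `K n` and its square agree modulo `J`.
  have hanti : Antitone fun n => (K n).map J.mkQ := antitone_nat_of_succ_le fun n => by
    refine Submodule.map_mono ?_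
    simp only [K, Function.iterate_succ_apply']
    exact idealSq_le (hK n).1
  obtain ⟨n, hn⟩ := IsArtinian.monotone_stabilizes (R := ℂ) (M := B ⧸ J) ⟨_, hanti⟩
  have hn1 : (K n).map J.mkQ = (K (n + 1)).map J.mkQ := hn (n + 1) (Nat.le_succ n)
  have hle : K n ≤ idealSq (K n) ⊔ J := by
    have h1 : K n ≤ ((K n).map J.mkQ).comap J.mkQ := Submodule.le_comap_map _ _
    rw [hn1, Submodule.comap_map_eq, Submodule.ker_mkQ] at h1
    simpa only [K, Function.iterate_succ_apply'] using h1
  exact isClosed_of_cofinite_le (hK n).2.1 (hK n).2.2.1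
    (le_of_le_idealSq_sup hJ hcof (hK n).1 (hK n).2.2.2 hle)

end CofiniteIdeals

/-! ### Closedness and finite codimension tested by linear functionals -/

section FunctionalCriterion

/-- In infinite dimension, the functional taking the value `n ‖b n‖` at the `n`-th of a sequence of
distinct basis vectors is unbounded. -/
lemma finiteDimensional_of_forall_continuous {Q : Type*} [NormedAddCommGroup Q] [NormedSpace ℂ Q]
    (h : ∀ f : Q →ₗ[ℂ] ℂ, Continuous f) : FiniteDimensional ℂ Q := by
  by_contra hQ
  let b := Module.Basis.ofVectorSpace ℂ Q
  have hinf : Infinite (Module.Basis.ofVectorSpaceIndex ℂ Q) := by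
    by_contra hfin
    rw [not_infinite_iff_finite] at hfin
    exact hQ (Module.Finite.of_basis b)
  let e := Infinite.natEmbedding (Module.Basis.ofVectorSpaceIndex ℂ Q)
  let f : Q →ₗ[ℂ] ℂ := b.constr ℂ (Function.extend e (fun n => (n : ℂ) * ‖b (e n)‖) 0)
  have hf : ∀ n, f (b (e n)) = (n : ℂ) * ‖b (e n)‖ := fun n => by
    simp only [f, Module.Basis.constr_basis]
    exact e.injective.extend_apply _ _ n
  let F : Q →L[ℂ] ℂ := ⟨f, h f⟩
  obtain ⟨n, hn⟩ := exists_nat_gt ‖F‖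
  have h1 : ‖f (b (e n))‖ ≤ ‖F‖ * ‖b (e n)‖ := F.le_opNorm _
  have h2 : 0 < ‖b (e n)‖ := norm_pos_iff.2 (b.ne_zero _)
  rw [hf, norm_mul, Complex.norm_natCast, Complex.norm_real, norm_norm] at h1
  exact absurd (le_of_mul_le_mul_right h1 h2) (not_le.2 hn)

variable {B : Type u} [NonUnitalNormedRing B] [NormedSpace ℂ B]

/-- A subspace is the intersection of the kernels of all functionals vanishing on it, which gives
closedness. The functionals on the quotient correspond to these same functionals, so all of them are
continuous. -/
lemma isClosed_and_isCofinite_of_forall_continuous {N : Submodule ℂ B}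
    (h : ∀ f : B →ₗ[ℂ] ℂ, N ≤ LinearMap.ker f → Continuous f) :
    IsClosed (N : Set B) ∧ IsCofinite N := by
  have hN : IsClosed (N : Set B) := by
    have : (N : Set B) = ⋂ f : {f : B →ₗ[ℂ] ℂ // N ≤ LinearMap.ker f}, f.1 ⁻¹' {0} := by
      ext x
      simp only [Set.mem_iInter, Set.mem_preimage, Set.mem_singleton_iff, SetLike.mem_coe]
      refine ⟨fun hx f => f.2 hx, fun hx => ?_⟩
      by_contra hxN
      obtain ⟨f, hf, hfN⟩ := Submodule.exists_le_ker_of_notMem hxN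
      exact hf (hx ⟨f, hfN⟩)
    rw [this]
    exact isClosed_iInter fun f => isClosed_singleton.preimage (h f.1 f.2)
  refine ⟨hN, ?_⟩
  have : IsClosed (N : Set B) := hN
  refine finiteDimensional_of_forall_continuous fun f => ?_
  have h1 := h (f ∘ₗ N.mkQ) (fun x hx => by simp [(Submodule.Quotient.mk_eq_zero N).2 hx])
  exact (Submodule.isOpenQuotientMap_mkQ N).isQuotientMap.continuous_iff.2 h1

lemma IsCofinite.exists_finset {I : Submodule ℂ B} (hI : IsCofinite I) :
    ∃ s : Finset B, Submodule.span ℂ (s : Set B) ⊔ I = ⊤ := by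
  classical
  have : FiniteDimensional ℂ (B ⧸ I) := hI
  obtain ⟨s, hs⟩ := (IsNoetherian.noetherian (⊤ : Submodule ℂ (B ⧸ I)))
  refine ⟨s.image Quotient.out, ?_⟩
  have : (Submodule.span ℂ ((s.image Quotient.out : Finset B) : Set B)).map I.mkQ = ⊤ := by
    rw [Submodule.map_span, ← hs, Finset.coe_image, Set.image_image]
    congr 1
    have : ∀ x : B ⧸ I, I.mkQ (Quotient.out x) = x := fun x => Quotient.out_eq x
    simp [this]
  have h2 := congrArg (Submodule.comap I.mkQ) this
  rwa [Submodule.comap_map_eq, Submodule.ker_mkQ, Submodule.comap_top] at h2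

variable [IsScalarTower ℂ B B] [SMulCommClass ℂ B B]

/-- The largest two-sided ideal contained in both `I` and the kernel of `f`. -/
def idealKernel (I : Submodule ℂ B) (f : B →ₗ[ℂ] ℂ) : Submodule ℂ B where
  carrier := {b | b ∈ I ∧ f b = 0 ∧ (∀ a, f (a * b) = 0) ∧ (∀ a, f (b * a) = 0) ∧
    ∀ a c, f (a * b * c) = 0}
  zero_mem' := by simp
  add_mem' := by
    rintro x y ⟨h1, h2, h3, h4, h5⟩ ⟨k1, k2, k3, k4, k5⟩
    exact ⟨I.add_mem h1 k1, by simp [h2, k2], fun a => by simp [mul_add, h3, k3],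
      fun a => by simp [add_mul, h4, k4], fun a c => by simp [mul_add, add_mul, h5, k5]⟩
  smul_mem' := by
    rintro t x ⟨h1, h2, h3, h4, h5⟩
    exact ⟨I.smul_mem t h1, by simp [h2], fun a => by simp [mul_smul_comm, h3],
      fun a => by simp [smul_mul_assoc, h4], fun a c => by simp [mul_smul_comm, smul_mul_assoc, h5]⟩

lemma isTwoSidedIdeal_idealKernel {I : Submodule ℂ B} (hI : IsTwoSidedIdeal I) (f : B →ₗ[ℂ] ℂ) :
    IsTwoSidedIdeal (idealKernel I f) := by
  rintro a b ⟨h1, h2, h3, h4, h5⟩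
  refine ⟨⟨(hI a b h1).1, h3 a, fun x => ?_, fun x => h5 a x, fun x y => ?_⟩,
    ⟨(hI a b h1).2, h4 a, fun x => ?_, fun x => ?_, fun x y => ?_⟩⟩
  · rw [← mul_assoc, h3]
  · rw [← mul_assoc, h5]
  · rw [← mul_assoc, h5]
  · rw [mul_assoc, h4]
  · rw [← mul_assoc, mul_assoc _ a y, h5]

lemma idealSq_le_idealKernel {I : Submodule ℂ B} (hI : IsTwoSidedIdeal I) {f : B →ₗ[ℂ] ℂ}
    (hf : idealSq I ≤ LinearMap.ker f) : idealSq I ≤ idealKernel I f := by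
  intro b hb
  have h := isTwoSidedIdeal_idealSq hI
  exact ⟨idealSq_le hI hb, hf hb, fun a => hf (h a b hb).1, fun a => hf (h a b hb).2,
    fun a c => hf (h c _ (h a b hb).1).2⟩

/-- Finitely many linear conditions suffice: modulo `I` the multipliers run through the span of a
finite set `s`, and a multiplier in `I` contributes nothing because `f` kills `I²`. -/
lemma isCofinite_idealKernel {I : Submodule ℂ B} (hI : IsTwoSidedIdeal I) (hcof : IsCofinite I)
    {f : B →ₗ[ℂ] ℂ} (hf : idealSq I ≤ LinearMap.ker f) : IsCofinite (idealKernel I f) := by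
  obtain ⟨s, hs⟩ := hcof.exists_finset
  have hsq : ∀ x ∈ I, ∀ y ∈ I, f (x * y) = 0 := fun x hx y hy =>
    hf (Submodule.subset_span ⟨x, hx, y, hy, rfl⟩)
  have hker : ∀ g : B →ₗ[ℂ] ℂ, (∀ a ∈ s, g a = 0) → (∀ a ∈ I, g a = 0) → ∀ a, g a = 0 := by
    intro g h1 h2 a
    have : (⊤ : Submodule ℂ B) ≤ LinearMap.ker g := by
      rw [← hs]
      exact sup_le (Submodule.span_le.2 fun a ha => h1 a ha) fun a ha => h2 a ha
    exact this trivial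
  have hfin : IsCofinite (I ⊓ LinearMap.ker (f.prod
      ((LinearMap.pi fun a : s => f ∘ₗ LinearMap.mulLeft ℂ (a : B)).prod
        ((LinearMap.pi fun a : s => f ∘ₗ LinearMap.mulRight ℂ (a : B)).prod
          (LinearMap.pi fun p : s × s => f ∘ₗ LinearMap.mulRight ℂ (p.2 : B) ∘ₗ
            LinearMap.mulLeft ℂ (p.1 : B)))))) := hcof.inf (isCofinite_ker _)
  refine hfin.mono ?_
  rintro b ⟨hb, hb'⟩
  simp only [SetLike.mem_coe, LinearMap.mem_ker, LinearMap.prod_apply, Function.prod_apply,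
    Prod.mk_eq_zero, funext_iff, LinearMap.pi_apply, LinearMap.comp_apply,
    LinearMap.mulLeft_apply, LinearMap.mulRight_apply, Pi.zero_apply, Subtype.forall,
    Prod.forall] at hb hb'
  obtain ⟨h1, h2, h3, h4⟩ := hb'
  refine ⟨hb, h1, hker (f ∘ₗ LinearMap.mulRight ℂ b) (fun a ha => h2 a ha)
    (fun a ha => hsq a ha b hb), hker (f ∘ₗ LinearMap.mulLeft ℂ b) (fun a ha => h3 a ha)
    (fun a ha => hsq b hb a ha), fun a c => ?_⟩
  refine hker (f ∘ₗ LinearMap.mulRight ℂ c ∘ₗ LinearMap.mulRight ℂ b) (fun a ha => ?_)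
    (fun a ha => ?_) a
  · exact hker (f ∘ₗ LinearMap.mulLeft ℂ (a * b)) (fun c hc => h4 a ha c hc)
      (fun c hc => hsq _ (hI a b hb).1 c hc) c
  · change f (a * b * c) = 0
    rw [mul_assoc]
    exact hsq a ha _ (hI c b hb).2

lemma idealSq_isClosed_and_isCofinite {I : Submodule ℂ B} (hI : IsTwoSidedIdeal I)
    (hcof : IsCofinite I) (h : ∀ J : Submodule ℂ B, IsTwoSidedIdeal J → IsCofinite J →
      idealSq I ≤ J → J ≤ I → IsClosed (J : Set B)) :
    IsClosed (idealSq I : Set B) ∧ IsCofinite (idealSq I) := by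
  refine isClosed_and_isCofinite_of_forall_continuous fun f hf => ?_
  have h1 := isCofinite_idealKernel hI hcof hf
  exact continuous_of_cofinite_le_ker (h _ (isTwoSidedIdeal_idealKernel hI f) h1
    (idealSq_le_idealKernel hI hf) fun b hb => hb.1) h1 f fun b hb => hb.2.1

end FunctionalCriterion

/-! ### Vanishing of second cohomology by averaging over a compact group -/

section Averaging

variable {B : Type u} [NonUnitalNormedRing B] [NormedSpace ℂ B] [IsScalarTower ℂ B B]
  [SMulCommClass ℂ B B]

/-- The failure of a linear map into a bimodule to be a derivation, as a bilinear map. -/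
def BanachBimodule.defect {X : Type w} [NormedAddCommGroup X] [NormedSpace ℂ X]
    (M : BanachBimodule B X) (D : B →ₗ[ℂ] X) : B →ₗ[ℂ] B →ₗ[ℂ] X :=
  LinearMap.mk₂ ℂ (fun a b => D (a * b) - M.left a (D b) - M.right b (D a))
    (fun a a' b => by simp only [add_mul, map_add, LinearMap.add_apply]; abel)
    (fun t a b => by simp only [smul_mul_assoc, map_smul, LinearMap.smul_apply, smul_sub])
    (fun a b b' => by simp only [mul_add, map_add, LinearMap.add_apply]; abel)
    (fun t a b => by simp only [mul_smul_comm, map_smul, LinearMap.smul_apply, smul_sub])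

lemma BanachBimodule.defect_apply {X : Type w} [NormedAddCommGroup X] [NormedSpace ℂ X]
    (M : BanachBimodule B X) (D : B →ₗ[ℂ] X) (a b : B) :
    M.defect D a b = D (a * b) - M.left a (D b) - M.right b (D a) := rfl

/-- The Hochschild cocycle identity. The defect is the coboundary of `D` on `B`; it is of interest
when it descends to a quotient of `B` while `D` does not. -/
lemma BanachBimodule.defect_cocycle {X : Type w} [NormedAddCommGroup X] [NormedSpace ℂ X]
    (M : BanachBimodule B X) (D : B →ₗ[ℂ] X) (a b d : B) :
    M.left a (M.defect D b d) =
      M.defect D (a * b) d - M.defect D a (b * d) + M.right d (M.defect D a b) := by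
  simp only [M.defect_apply, map_sub, M.left_mul, M.right_mul, M.left_right, mul_assoc]
  abel

/-- Vanishing of the second cohomology of an algebra spanned by a compact group: a linear map
whose defect factors through the quotient by `ker ρ` can be corrected to a derivation. -/
theorem BanachBimodule.exists_isDerivation {E : Type*} [NormedRing E] [NormedAlgebra ℂ E]
    [FiniteDimensional ℂ E] (ρ : B →ₗ[ℂ] E) (hρ : ∀ a b, ρ (a * b) = ρ a * ρ b)
    (K : Subgroup Eˣ) [CompactSpace K] (hK : ∀ u ∈ K, ∃ b, ρ b = u)
    (hspan : ∀ b, ρ b ∈ Submodule.span ℂ ((fun u : Eˣ => (u : E)) '' K))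
    {X : Type w} [NormedAddCommGroup X] [NormedSpace ℂ X] [FiniteDimensional ℂ X]
    (M : BanachBimodule B X) (hr : ∀ b, ρ b = 0 → M.right b = 0)
    (D : B →ₗ[ℂ] X) (hD₁ : ∀ a b, ρ a = 0 → M.defect D a b = 0)
    (hD₂ : ∀ a b, ρ b = 0 → M.defect D a b = 0) :
    ∃ D' : B →ₗ[ℂ] X, M.IsDerivation D' ∧ ∀ b, ρ b = 0 → D' b = D b := by
  obtain ⟨σ₀, hσ₀⟩ := LinearMap.exists_rightInverse_of_surjective ρ.rangeRestrict
    (LinearMap.range_eq_top.2 ρ.surjective_rangeRestrict)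
  obtain ⟨p, hp⟩ := LinearMap.exists_leftInverse_of_injective (LinearMap.range ρ).subtype
    (Submodule.ker_subtype _)
  -- A linear section of `ρ` over its range, extended to `E` by a projection. It need not be
  -- multiplicative, which is harmless since the defect and the right action see only values of `ρ`.
  let σ : E →ₗ[ℂ] B := σ₀ ∘ₗ p
  have hσ : ∀ b, ρ (σ (ρ b)) = ρ b := by
    intro b
    have h1 : p (ρ b) = ⟨ρ b, b, rfl⟩ := LinearMap.congr_fun hp ⟨ρ b, b, rfl⟩
    have h2 := LinearMap.congr_fun hσ₀ ⟨ρ b, b, rfl⟩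
    simp only [σ, LinearMap.comp_apply, h1]
    exact congrArg Subtype.val h2
  have hσK : ∀ u ∈ K, ρ (σ (u : E)) = u := by
    intro u hu
    obtain ⟨b, hb⟩ := hK u hu
    rw [← hb, hσ]
  have hc₁ : ∀ a a' b, ρ a = ρ a' → M.defect D a b = M.defect D a' b := by
    intro a a' b h
    have := hD₁ (a - a') b (by rw [map_sub, h, sub_self])
    rwa [map_sub, LinearMap.sub_apply, sub_eq_zero] at this
  have hc₂ : ∀ a b b', ρ b = ρ b' → M.defect D a b = M.defect D a b' := by
    intro a b b' h
    have := hD₂ a (b - b') (by rw [map_sub, h, sub_self])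
    rwa [map_sub, sub_eq_zero] at this
  have hr' : ∀ b b', ρ b = ρ b' → M.right b = M.right b' := by
    intro b b' h
    have := hr (b - b') (by rw [map_sub, h, sub_self])
    rwa [map_sub, sub_eq_zero] at this
  obtain ⟨b₀, hb₀⟩ := hK 1 K.one_mem
  let _ : MeasurableSpace K := borel K
  have : BorelSpace K := ⟨rfl⟩
  let μ : Measure K := Measure.haarMeasure ⊤
  have hμ : IsProbabilityMeasure μ := ⟨by
    have := Measure.haarMeasure_self (K₀ := (⊤ : TopologicalSpace.PositiveCompacts K))
    simpa using this⟩
  let R : E →L[ℂ] X →L[ℂ] X := LinearMap.toContinuousLinearMap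
    ((LinearMap.toContinuousLinearMap : (X →ₗ[ℂ] X) ≃ₗ[ℂ] _).toLinearMap ∘ₗ M.right ∘ₗ σ)
  have hR : ∀ e x, R e x = M.right (σ e) x := fun e x => rfl
  have hcont : ∀ C : E →ₗ[ℂ] X, Integrable
      (fun u : K => M.right (σ ((u⁻¹ : K) : Eˣ)) (C (u : Eˣ))) μ := by
    intro C
    have hC : Continuous C := C.continuous_of_finiteDimensional
    have h1 : Continuous fun u : K => M.right (σ ((u⁻¹ : K) : Eˣ)) (C (u : Eˣ)) := by
      simp_rw [← hR]
      exact (R.continuous.comp (Units.continuous_val.comp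
        (continuous_subtype_val.comp continuous_inv))).clm_apply
          (hC.comp (Units.continuous_val.comp continuous_subtype_val))
    exact h1.integrable_of_hasCompactSupport (HasCompactSupport.of_compactSpace _)
  have hint : ∀ a, Integrable
      (fun u : K => M.right (σ ((u⁻¹ : K) : Eˣ)) (M.defect D a (σ (u : Eˣ)))) μ :=
    fun a => hcont (M.defect D a ∘ₗ σ)
  have hint' : ∀ a b, Integrable
      (fun u : K => M.right (σ ((u⁻¹ : K) : Eˣ)) (M.defect D a (b * σ (u : Eˣ)))) μ :=
    fun a b => hcont (M.defect D a ∘ₗ LinearMap.mulLeft ℂ b ∘ₗ σ)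
  -- With `c` the defect, this is `h₁(a) = ∫ c(a, u) u⁻¹ du`, the averaged candidate for the
  -- correction.
  let h₁ : B →ₗ[ℂ] X :=
    { toFun := fun a => ∫ u : K, M.right (σ ((u⁻¹ : K) : Eˣ)) (M.defect D a (σ (u : Eˣ))) ∂μ
      map_add' := fun a a' => by
        rw [← integral_add (hint a) (hint a')]
        simp
      map_smul' := fun t a => by
        rw [RingHom.id_apply, ← integral_smul]
        simp }
  have hh₁ : ∀ a, h₁ a =
    ∫ u : K, M.right (σ ((u⁻¹ : K) : Eˣ)) (M.defect D a (σ (u : Eˣ))) ∂μ := fun a => rfl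
  have hinv : ∀ a b, ∫ u : K, M.right (σ ((u⁻¹ : K) : Eˣ)) (M.defect D a (b * σ (u : Eˣ))) ∂μ =
      M.right b (h₁ a) := by
    intro a b
    -- Both sides depend on `b` only through `ρ b`, so one suitable `b` above each element of the
    -- span is enough, and linearity reduces to elements of `K`.
    suffices h : ∀ e ∈ Submodule.span ℂ ((fun u : Eˣ => (u : E)) '' K), ∃ b, ρ b = e ∧
        ∫ u : K, M.right (σ ((u⁻¹ : K) : Eˣ)) (M.defect D a (b * σ (u : Eˣ))) ∂μ =
          M.right b (h₁ a) by
      obtain ⟨b', hb', h'⟩ := h _ (hspan b)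
      rw [← hr' _ _ hb', ← h']
      congr 1
      ext u
      exact congrArg _ (hc₂ a _ _ (by rw [hρ b, hρ b', hb']))
    intro e he
    induction he using Submodule.span_induction with
    | mem e he =>
      obtain ⟨v, hv, rfl⟩ := he
      refine ⟨σ (v : E), hσK v hv, ?_⟩
      -- Left invariance under `u ↦ v⁻¹ u` turns `c(a, v u) u⁻¹` into `c(a, u) u⁻¹ v`.
      rw [hh₁, ← integral_mul_left_eq_self _ ((⟨v, hv⟩ : K)⁻¹)]
      change _ = (M.right (σ (v : E))).toContinuousLinearMap _
      rw [← ContinuousLinearMap.integral_comp_comm _ (hint a)]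
      congr 1
      ext u
      change _ = M.right (σ (v : E)) _
      rw [← M.right_mul]
      have e1 : M.right (σ (((⟨v, hv⟩⁻¹ * u)⁻¹ : K) : Eˣ)) =
          M.right (σ ((u⁻¹ : K) : Eˣ) * σ (v : E)) := hr' _ _ (by
        rw [hρ, hσK _ (SetLike.coe_mem _), hσK _ (SetLike.coe_mem _), hσK v hv]
        simp)
      rw [e1]
      refine congrArg _ (hc₂ a _ _ ?_)
      rw [hρ, hσK _ (SetLike.coe_mem _), hσK _ (SetLike.coe_mem _), hσK v hv]
      simp
    | zero => exact ⟨0, by simp, by simp⟩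
    | add e e' _ _ h h' =>
      obtain ⟨b, rfl, hb⟩ := h
      obtain ⟨b', rfl, hb'⟩ := h'
      refine ⟨b + b', map_add _ _ _, ?_⟩
      simp only [add_mul, map_add, LinearMap.add_apply, ← hb, ← hb']
      exact integral_add (hint' a b) (hint' a b')
    | smul t e _ h =>
      obtain ⟨b, rfl, hb⟩ := h
      refine ⟨t • b, map_smul _ _ _, ?_⟩
      simp only [smul_mul_assoc, map_smul, LinearMap.smul_apply, ← hb]
      exact integral_smul _ _
  have hleft : ∀ a b, M.left a (h₁ b) =
      h₁ (a * b) - M.right b (h₁ a) + M.right b₀ (M.defect D a b) := by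
    intro a b
    change (M.left a).toContinuousLinearMap _ = _
    rw [hh₁ b, ← ContinuousLinearMap.integral_comp_comm _ (hint b), ← hinv a b, hh₁ (a * b)]
    have hone : M.right b₀ (M.defect D a b) = ∫ _ : K, M.right b₀ (M.defect D a b) ∂μ := by simp
    have hsub := integral_add ((hint (a * b)).sub (hint' a b))
      (integrable_const (μ := μ) (M.right b₀ (M.defect D a b)))
    simp only [Pi.sub_apply] at hsub
    rw [hone, ← integral_sub (hint _) (hint' _ _), ← hsub]
    congr 1
    ext u
    change M.left a _ = _
    have e1 : M.right b₀ = M.right (σ (u : Eˣ) * σ ((u⁻¹ : K) : Eˣ)) := hr' _ _ (by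
      rw [hρ, hσK _ (SetLike.coe_mem _), hσK _ (SetLike.coe_mem _), hb₀]
      simp)
    rw [M.left_right, M.defect_cocycle, e1, M.right_mul]
    simp
  -- The element `b₀` above the unit need not act as the identity on `X`, so `D + h₁` still has
  -- defect `c - c b₀`. The term `h₂` removes it.
  let h₂ : B →ₗ[ℂ] X := (M.right b₀ - LinearMap.id) ∘ₗ (M.defect D).flip b₀
  have hh₂ : ∀ a, h₂ a = M.right b₀ (M.defect D a b₀) - M.defect D a b₀ := fun a => rfl
  have hb₀' : ∀ b, M.right (b₀ * b) = M.right b ∧ M.right (b * b₀) = M.right b := fun b =>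
    ⟨hr' _ _ (by simp [hρ, hb₀]), hr' _ _ (by simp [hρ, hb₀])⟩
  have hleft₂ : ∀ a b, M.left a (h₂ b) = h₂ (a * b) + M.defect D a b -
      M.right b₀ (M.defect D a b) := by
    intro a b
    have e1 : M.defect D a (b * b₀) = M.defect D a b := hc₂ _ _ _ (by simp [hρ, hb₀])
    have e2 : ∀ ξ, M.right b₀ (M.right b₀ ξ) = M.right b₀ ξ := fun ξ => by
      rw [← M.right_mul, (hb₀' b₀).1]
    rw [hh₂, hh₂, map_sub, M.left_right, M.defect_cocycle, e1]
    simp only [map_add, map_sub, e2]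
    abel
  have hright₂ : ∀ a b, M.right b (h₂ a) = 0 := by
    intro a b
    rw [hh₂, map_sub, ← M.right_mul, (hb₀' b).1, sub_self]
  refine ⟨D + h₁ + h₂, fun a b => ?_, fun b hb => ?_⟩
  · have := M.defect_apply D a b
    simp only [LinearMap.add_apply, map_add, hleft, hleft₂, hright₂, this]
    abel
  · have e1 : h₁ b = 0 := by
      rw [hh₁]
      simp [hD₁ b _ hb]
    simp [e1, hh₂, hD₁ b _ hb]

end Averaging

/-! ### Square-zero extensions and extension of the quotient map to a derivation -/

section SquareZero

variable {B : Type u} [NonUnitalNormedRing B] [NormedSpace ℂ B] [IsScalarTower ℂ B B]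
  [SMulCommClass ℂ B B]

/-- The bimodule is `X = I/J`, on which `I` acts as zero from both sides because `I² ≤ J`; hence the
actions factor through `B ⧸ I` and are continuous. Averaging yields a derivation that restricts to
the quotient map on `I`, so `J` is the part of `I` where a continuous map vanishes. -/
lemma isClosed_of_idealSq_le (hder : FiniteDimDerivationsContinuous.{u, w} B)
    {E : Type*} [NormedRing E] [NormedAlgebra ℂ E]
    [FiniteDimensional ℂ E] (ρ : B →ₗ[ℂ] E) (hρ : ∀ a b, ρ (a * b) = ρ a * ρ b)
    (K : Subgroup Eˣ) [CompactSpace K] (hK : ∀ u ∈ K, ∃ b, ρ b = u)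
    (hspan : ∀ b, ρ b ∈ Submodule.span ℂ ((fun u : Eˣ => (u : E)) '' K))
    {I J : Submodule ℂ B} (hI : IsTwoSidedIdeal I) (hIc : IsClosed (I : Set B))
    (hIcof : IsCofinite I) (hker : ∀ b, ρ b = 0 ↔ b ∈ I) (hJ : IsTwoSidedIdeal J)
    (hJcof : IsCofinite J) (hsq : idealSq I ≤ J) (hJI : J ≤ I) : IsClosed (J : Set B) := by
  have : FiniteDimensional ℂ (B ⧸ J) := hJcof
  let V : Submodule ℂ (B ⧸ J) := I.map J.mkQ
  let X := ULift.{w} (Fin (Module.finrank ℂ V) → ℂ)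
  let e : V ≃ₗ[ℂ] X := (Module.finBasis ℂ V).equivFun.trans ULift.moduleEquiv.symm
  obtain ⟨q, hq⟩ := LinearMap.exists_leftInverse_of_injective V.subtype (Submodule.ker_subtype _)
  -- As `q` retracts `B ⧸ J` onto the image of `I`, the restriction of `π` to `I` is the quotient
  -- map `I → I/J` in coordinates.
  let π : B →ₗ[ℂ] X := e.toLinearMap ∘ₗ q ∘ₗ J.mkQ
  have hπI : ∀ i (hi : i ∈ I), π i = e ⟨J.mkQ i, i, hi, rfl⟩ := fun i hi =>
    congrArg e (LinearMap.congr_fun hq ⟨J.mkQ i, i, hi, rfl⟩)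
  have hπJ : ∀ i ∈ I, π i = 0 ↔ i ∈ J := by
    intro i hi
    rw [hπI i hi, LinearEquiv.map_eq_zero_iff, Subtype.ext_iff]
    exact Submodule.Quotient.mk_eq_zero J
  have hsurj : Function.Surjective (π.domRestrict I) := by
    intro x
    obtain ⟨⟨_, i, hi, rfl⟩, hx⟩ := e.surjective x
    exact ⟨⟨i, hi⟩, (hπI i hi).trans hx⟩
  obtain ⟨t₀, ht₀⟩ := LinearMap.exists_rightInverse_of_surjective _ (LinearMap.range_eq_top.2 hsurj)
  let t : X →ₗ[ℂ] B := I.subtype ∘ₗ t₀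
  have htI : ∀ x, t x ∈ I := fun x => (t₀ x).2
  have ht : ∀ x, π (t x) = x := fun x => LinearMap.congr_fun ht₀ x
  have htπ : ∀ i ∈ I, i - t (π i) ∈ J := fun i hi =>
    (hπJ _ (I.sub_mem hi (htI _))).1 (by rw [map_sub, ht, sub_self])
  have hleft : ∀ a, ∀ i ∈ I, π (a * t (π i)) = π (a * i) := by
    intro a i hi
    have h := (hJ a _ (htπ i hi)).1
    have h' := (hπJ _ (hJI h)).2 h
    rwa [mul_sub, map_sub, sub_eq_zero, eq_comm] at h'
  have hright : ∀ a, ∀ i ∈ I, π (t (π i) * a) = π (i * a) := by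
    intro a i hi
    have h := (hJ a _ (htπ i hi)).2
    have h' := (hπJ _ (hJI h)).2 h
    rwa [sub_mul, map_sub, sub_eq_zero, eq_comm] at h'
  have hII : ∀ a ∈ I, ∀ b ∈ I, π (a * b) = 0 := fun a ha b hb =>
    (hπJ _ (hI a b hb).1).2 (hsq (Submodule.subset_span ⟨a, ha, b, hb, rfl⟩))
  let l : B →ₗ[ℂ] X →ₗ[ℂ] X := LinearMap.mk₂ ℂ (fun a x => π (a * t x))
    (fun a b x => by rw [add_mul, map_add]) (fun c a x => by rw [smul_mul_assoc, map_smul])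
    (fun a x y => by rw [map_add, mul_add, map_add])
    (fun c a x => by rw [map_smul, mul_smul_comm, map_smul])
  let r : B →ₗ[ℂ] X →ₗ[ℂ] X := LinearMap.mk₂ ℂ (fun a x => π (t x * a))
    (fun a b x => by rw [mul_add, map_add]) (fun c a x => by rw [mul_smul_comm, map_smul])
    (fun a x y => by rw [map_add, add_mul, map_add])
    (fun c a x => by rw [map_smul, smul_mul_assoc, map_smul])
  have hl : ∀ a x, l a x = π (a * t x) := fun a x => rfl
  have hr : ∀ a x, r a x = π (t x * a) := fun a x => rfl
  have hcont : ∀ f : B →ₗ[ℂ] X →ₗ[ℂ] X, I ≤ LinearMap.ker f →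
      Continuous fun p : B × X => f p.1 p.2 := by
    intro f hf
    let F : B →ₗ[ℂ] X →L[ℂ] X :=
      (LinearMap.toContinuousLinearMap : (X →ₗ[ℂ] X) ≃ₗ[ℂ] _).toLinearMap ∘ₗ f
    have hF : Continuous F := continuous_of_cofinite_le_ker hIc hIcof F fun b hb => by
      have : f b = 0 := hf hb
      simp [F, this]
    exact (hF.comp continuous_fst).clm_apply continuous_snd
  let M : BanachBimodule B X :=
    { left := l
      right := r
      left_mul := fun a b x => by
        rw [hl, hl, hl, hleft a _ (hI b _ (htI x)).1, mul_assoc]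
      right_mul := fun a b x => by
        rw [hr, hr, hr, hright b _ (hI a _ (htI x)).2, mul_assoc]
      left_right := fun a b x => by
        rw [hl, hr, hl, hr, hright b _ (hI a _ (htI x)).1, hleft a _ (hI b _ (htI x)).2, mul_assoc]
      continuous_left := hcont l fun b hb => LinearMap.ext fun x => hII b hb _ (htI x)
      continuous_right := hcont r fun b hb => LinearMap.ext fun x => hII _ (htI x) b hb }
  -- A linear projection `p` of `B` onto `I`. The defect of `π ∘ p` vanishes as soon as one argument
  -- lies in `I`, which is what allows averaging over a group in the image of `ρ`.
  obtain ⟨p, hp⟩ := LinearMap.exists_leftInverse_of_injective I.subtype (Submodule.ker_subtype _)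
  have hpI : ∀ i ∈ I, (p i : B) = i := fun i hi =>
    congrArg Subtype.val (LinearMap.congr_fun hp ⟨i, hi⟩)
  have hdef : ∀ a b, M.defect (π ∘ₗ I.subtype ∘ₗ p) a b =
      π (p (a * b)) - π (a * p b) - π (p a * b) := by
    intro a b
    rw [M.defect_apply]
    change π (p (a * b)) - π (a * t (π (p b))) - π (t (π (p a)) * b) = _
    rw [hleft a _ (p b).2, hright b _ (p a).2]
  obtain ⟨D, hD, hDI⟩ := M.exists_isDerivation ρ hρ K hK hspan
    (fun b hb => LinearMap.ext fun x => hII _ (htI x) b ((hker b).1 hb)) (π ∘ₗ I.subtype ∘ₗ p)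
    (fun a b ha => by
      have ha' := (hker a).1 ha
      rw [hdef, hpI _ ha', hpI _ (hI b a ha').2, hII a ha' _ (p b).2]
      simp)
    (fun a b hb => by
      have hb' := (hker b).1 hb
      rw [hdef, hpI _ hb', hpI _ (hI a b hb').1, hII _ (p a).2 b hb']
      simp)
  have hcD : Continuous D := hder X M D hD
  have hJD : (J : Set B) = (I : Set B) ∩ D ⁻¹' {0} := by
    ext b
    simp only [SetLike.mem_coe, Set.mem_inter_iff, Set.mem_preimage, Set.mem_singleton_iff]
    have key : ∀ b ∈ I, D b = π b := fun b hb => by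
      rw [hDI b ((hker b).2 hb)]
      change π (p b) = π b
      rw [hpI b hb]
    exact ⟨fun hb => ⟨hJI hb, by rw [key b (hJI hb), (hπJ b (hJI hb)).2 hb]⟩,
      fun ⟨hb, h0⟩ => (hπJ b hb).1 (by rw [← key b hb, h0])⟩
  rw [hJD]
  exact hIc.inter (isClosed_singleton.preimage hcD)

end SquareZero

/-! ### Compact groups of contractive units -/

section ContractiveUnits

/-- The units of a normed ring which are contractive and lie in `S`, together with their inverse. -/
def contractiveUnits {E : Type*} [NormedRing E] (S : Submonoid E) (h1 : ‖(1 : E)‖ ≤ 1) :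
    Subgroup Eˣ where
  carrier := {u | (‖(u : E)‖ ≤ 1 ∧ (u : E) ∈ S) ∧ (‖((u⁻¹ : Eˣ) : E)‖ ≤ 1 ∧ ((u⁻¹ : Eˣ) : E) ∈ S)}
  one_mem' := by simp [h1, S.one_mem]
  inv_mem' := by
    rintro u ⟨h1, h2⟩
    exact ⟨h2, by simpa using h1⟩
  mul_mem' := by
    rintro u v ⟨⟨h1, h2⟩, h3, h4⟩ ⟨⟨k1, k2⟩, k3, k4⟩
    refine ⟨⟨?_, S.mul_mem h2 k2⟩, ?_, ?_⟩
    · rw [Units.val_mul]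
      exact (norm_mul_le _ _).trans (mul_le_one₀ h1 (norm_nonneg _) k1)
    · rw [mul_inv_rev, Units.val_mul]
      exact (norm_mul_le _ _).trans (mul_le_one₀ k3 (norm_nonneg _) h3)
    · rw [mul_inv_rev, Units.val_mul]
      exact S.mul_mem k4 h4

/-- Under the closed embedding `u ↦ (u, u⁻¹)`, the group is the preimage of a product of two closed
bounded sets in finite dimension. -/
lemma compactSpace_contractiveUnits {E : Type*} [NormedRing E] [NormedAlgebra ℂ E]
    [FiniteDimensional ℂ E] (S : Submonoid E) (h1 : ‖(1 : E)‖ ≤ 1) (hS : IsClosed (S : Set E)) :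
    CompactSpace (contractiveUnits S h1) := by
  have : ProperSpace E := FiniteDimensional.proper ℂ E
  have hK : IsCompact (Metric.closedBall (0 : E) 1 ∩ S) :=
    (isCompact_closedBall _ _).inter_right hS
  refine isCompact_iff_compactSpace.1 ?_
  have h := Units.isClosedEmbedding_embedProduct (α := E)
  convert h.isCompact_preimage (hK.prod (hK.image MulOpposite.continuous_op))
  ext u
  simp [contractiveUnits, Units.embedProduct]

end ContractiveUnits

/-! ### Isometric multipliers acting on finite-dimensional quotients -/

section Multipliers

variable {B : Type u} [NonUnitalNormedRing B] [NormedSpace ℂ B] [IsScalarTower ℂ B B]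
  [SMulCommClass ℂ B B]

variable (B) in
/-- The isometric left multipliers of `B`. -/
def isometricLeftMultipliers : Set (B ≃ₗᵢ[ℂ] B) := {U | ∀ a b, U (a * b) = U a * b}

lemma symm_mem_isometricLeftMultipliers {U : B ≃ₗᵢ[ℂ] B} (hU : U ∈ isometricLeftMultipliers B) :
    U.symm ∈ isometricLeftMultipliers B := fun a b => by
  apply U.injective
  rw [hU, U.apply_symm_apply, U.apply_symm_apply]

/-- The left regular representation of `B` on a finite-dimensional quotient. -/
noncomputable def quotientRep (I : Submodule ℂ B) [IsClosed (I : Set B)] [FiniteDimensional ℂ (B ⧸ I)]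
    (hI : IsTwoSidedIdeal I) : B →ₗ[ℂ] (B ⧸ I) →L[ℂ] (B ⧸ I) where
  toFun b := LinearMap.toContinuousLinearMap (quotientMulLeft I hI b)
  map_add' a b := by
    ext x
    obtain ⟨x, rfl⟩ := I.mkQ_surjective x
    simp [add_mul]
  map_smul' c b := by
    ext x
    obtain ⟨x, rfl⟩ := I.mkQ_surjective x
    simp only [Submodule.mkQ_apply, LinearMap.coe_toContinuousLinearMap', quotientMulLeft_mk,
      RingHom.id_apply, smul_apply]
    rw [smul_mul_assoc]
    rfl

section

variable (I : Submodule ℂ B) [hIc : IsClosed (I : Set B)] [FiniteDimensional ℂ (B ⧸ I)]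
  (hI : IsTwoSidedIdeal I)

lemma quotientRep_mk (b x : B) :
    quotientRep I hI b (Submodule.Quotient.mk x) = Submodule.Quotient.mk (b * x) := rfl

lemma quotientRep_mul (a b : B) :
    quotientRep I hI (a * b) = quotientRep I hI a * quotientRep I hI b := by
  ext x
  obtain ⟨x, rfl⟩ := I.mkQ_surjective x
  change Submodule.Quotient.mk (a * b * x) = Submodule.Quotient.mk (a * (b * x))
  rw [mul_assoc]

/-- If `b x ∈ I` for all `x`, right approximate units exhibit `b` as a limit of elements `b e` of
the closed ideal `I`. -/
lemma quotientRep_eq_zero_iff (hR : ∀ b : B, ∀ ε > 0, ∃ e, ‖b * e - b‖ < ε) (b : B) :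
    quotientRep I hI b = 0 ↔ b ∈ I := by
  constructor
  · intro hb
    have h : ∀ x, b * x ∈ I := fun x =>
      (Submodule.Quotient.mk_eq_zero I).1 (DFunLike.congr_fun hb (Submodule.Quotient.mk x))
    refine hIc.closure_subset (Metric.mem_closure_iff.2 fun ε hε => ?_)
    obtain ⟨e, he⟩ := hR b ε hε
    exact ⟨b * e, h e, by rwa [dist_comm, dist_eq_norm]⟩
  · intro hb
    ext x
    obtain ⟨x, rfl⟩ := I.mkQ_surjective x
    exact (Submodule.Quotient.mk_eq_zero I).2 (hI x b hb).2

/-- An operator on `B ⧸ I` is determined by its values on a finite spanning set. There, left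
approximate units bring the range of the representation arbitrarily close to the identity, and that
range is closed. -/
lemma exists_quotientRep_eq_one
    (hL : ∀ F : Finset B, ∀ ε > 0, ∃ e : B, ∀ b ∈ F, ‖e * b - b‖ < ε) :
    ∃ e, quotientRep I hI e = 1 := by
  obtain ⟨s, hs⟩ := IsCofinite.exists_finset (I := I) ‹_›
  let ev : ((B ⧸ I) →L[ℂ] (B ⧸ I)) →ₗ[ℂ] (s → B ⧸ I) :=
    LinearMap.pi fun x =>
      { toFun := fun T => T (Submodule.Quotient.mk (x : B))
        map_add' := fun _ _ => rfl
        map_smul' := fun _ _ => rfl }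
  have hev : ∀ S T, ev S = ev T → S = T := by
    intro S T h
    ext x
    obtain ⟨x, rfl⟩ := I.mkQ_surjective x
    have : (⊤ : Submodule ℂ B) ≤
        LinearMap.ker ((S - T : (B ⧸ I) →L[ℂ] (B ⧸ I)).toLinearMap ∘ₗ I.mkQ) := by
      rw [← hs]
      refine sup_le (Submodule.span_le.2 fun a ha => ?_) fun a ha => ?_
      · have := congrFun h ⟨a, ha⟩
        exact sub_eq_zero.2 this
      · simp [(Submodule.Quotient.mk_eq_zero I).2 ha]
    exact sub_eq_zero.1 (this (trivial : x ∈ ⊤))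
  have hcl : IsClosed ((LinearMap.range (ev ∘ₗ quotientRep I hI) : Submodule ℂ (s → B ⧸ I)) :
      Set (s → B ⧸ I)) := Submodule.closed_of_finiteDimensional _
  have hmem : ev 1 ∈ LinearMap.range (ev ∘ₗ quotientRep I hI) := by
    refine hcl.closure_subset (Metric.mem_closure_iff.2 fun ε hε => ?_)
    obtain ⟨e, he⟩ := hL s ε hε
    refine ⟨_, ⟨e, rfl⟩, ?_⟩
    rw [dist_comm, dist_pi_lt_iff hε]
    rintro ⟨x, hx⟩
    rw [dist_eq_norm]
    refine lt_of_le_of_lt ?_ (he x hx)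
    exact Submodule.Quotient.norm_mk_le I (e * x - x)
  obtain ⟨e, he⟩ := hmem
  exact ⟨e, hev _ _ he⟩

/-- The elements of `B ⧸ I →L[ℂ] B ⧸ I` given by left multiplication with an element of `B`. -/
def quotientRepRange {e : B} (he : quotientRep I hI e = 1) :
    Submonoid ((B ⧸ I) →L[ℂ] (B ⧸ I)) where
  carrier := Set.range (quotientRep I hI)
  one_mem' := ⟨e, he⟩
  mul_mem' := by
    rintro _ _ ⟨a, rfl⟩ ⟨b, rfl⟩
    exact ⟨a * b, quotientRep_mul I hI a b⟩

lemma isClosed_quotientRepRange {e : B} (he : quotientRep I hI e = 1) :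
    IsClosed (quotientRepRange I hI he : Set ((B ⧸ I) →L[ℂ] (B ⧸ I))) :=
  (LinearMap.range (quotientRep I hI)).closed_of_finiteDimensional

/-- The group of invertible isometries of the quotient `B ⧸ I` that are given by
left multiplication with an element of `B`. -/
noncomputable def quotientIsometries {e : B} (he : quotientRep I hI e = 1) :
    Subgroup ((B ⧸ I) →L[ℂ] (B ⧸ I))ˣ :=
  contractiveUnits (E := (B ⧸ I) →L[ℂ] (B ⧸ I)) (quotientRepRange I hI he)
    ContinuousLinearMap.norm_id_le

lemma compactSpace_quotientIsometries {e : B} (he : quotientRep I hI e = 1) :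
    CompactSpace (quotientIsometries I hI he) :=
  compactSpace_contractiveUnits (E := (B ⧸ I) →L[ℂ] (B ⧸ I)) _ _ (isClosed_quotientRepRange I hI he)

variable {I} in
lemma IsTwoSidedIdeal.multiplier_mem {U : B ≃ₗᵢ[ℂ] B} (hU : U ∈ isometricLeftMultipliers B)
    (hI : IsTwoSidedIdeal I)
    (hL : ∀ F : Finset B, ∀ ε > 0, ∃ e : B, ∀ b ∈ F, ‖e * b - b‖ < ε) {b : B} (hb : b ∈ I) :
    U b ∈ I := by
  refine hIc.closure_subset (Metric.mem_closure_iff.2 fun ε hε => ?_)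
  obtain ⟨e, he⟩ := hL {b} ε hε
  refine ⟨U e * b, (hI _ b hb).1, ?_⟩
  rw [← hU, U.dist_map, dist_comm, dist_eq_norm]
  exact he b (Finset.mem_singleton_self b)

lemma quotientRep_multiplier {U : B ≃ₗᵢ[ℂ] B} (hU : U ∈ isometricLeftMultipliers B)
    (hL : ∀ F : Finset B, ∀ ε > 0, ∃ e : B, ∀ b ∈ F, ‖e * b - b‖ < ε)
    {e : B} (he : quotientRep I hI e = 1) (x : B) :
    quotientRep I hI (U e) (Submodule.Quotient.mk x) = Submodule.Quotient.mk (U x) := by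
  rw [quotientRep_mk, ← hU, Submodule.Quotient.eq, ← map_sub]
  refine IsTwoSidedIdeal.multiplier_mem hU hI hL ?_
  exact (Submodule.Quotient.eq I).1 (DFunLike.congr_fun he (Submodule.Quotient.mk x))

lemma norm_quotientRep_multiplier_le {U : B ≃ₗᵢ[ℂ] B} (hU : U ∈ isometricLeftMultipliers B)
    (hL : ∀ F : Finset B, ∀ ε > 0, ∃ e : B, ∀ b ∈ F, ‖e * b - b‖ < ε)
    {e : B} (he : quotientRep I hI e = 1) : ‖quotientRep I hI (U e)‖ ≤ 1 := by
  refine ContinuousLinearMap.opNorm_le_bound _ zero_le_one fun v => ?_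
  rw [one_mul]
  refine le_of_forall_pos_lt_add fun ε hε => ?_
  obtain ⟨x, rfl, hx⟩ := Submodule.Quotient.norm_mk_lt v hε
  rw [quotientRep_multiplier I hI hU hL he]
  exact ((Submodule.Quotient.norm_mk_le I _).trans_eq (U.norm_map x)).trans_lt hx

lemma quotientRep_multiplier_mem {U : B ≃ₗᵢ[ℂ] B} (hU : U ∈ isometricLeftMultipliers B)
    (hL : ∀ F : Finset B, ∀ ε > 0, ∃ e : B, ∀ b ∈ F, ‖e * b - b‖ < ε)
    {e : B} (he : quotientRep I hI e = 1) :
    ∃ u ∈ quotientIsometries I hI he, (u : (B ⧸ I) →L[ℂ] (B ⧸ I)) = quotientRep I hI (U e) := by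
  have hU' := symm_mem_isometricLeftMultipliers hU
  refine ⟨⟨quotientRep I hI (U e), quotientRep I hI (U.symm e), ?_, ?_⟩,
    ⟨⟨norm_quotientRep_multiplier_le I hI hU hL he, _, rfl⟩,
      norm_quotientRep_multiplier_le I hI hU' hL he, _, rfl⟩, rfl⟩
  all_goals
    ext x
    obtain ⟨x, rfl⟩ := I.mkQ_surjective x
    change quotientRep I hI _ (quotientRep I hI _ (Submodule.Quotient.mk x)) = _
    simp [quotientRep_multiplier I hI hU hL he, quotientRep_multiplier I hI hU' hL he]

/-- Because `e` acts as the identity, `b` may be replaced by `b e`, a limit of combinations of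
elements `U e`. Each of these maps into the group, whose span is closed by finite dimension. -/
lemma quotientRep_mem_span
    (hL : ∀ F : Finset B, ∀ ε > 0, ∃ e : B, ∀ b ∈ F, ‖e * b - b‖ < ε)
    (hU : ∀ a b : B, a * b ∈
      (Submodule.span ℂ ((fun U : B ≃ₗᵢ[ℂ] B => U b) '' isometricLeftMultipliers B)).topologicalClosure)
    {e : B} (he : quotientRep I hI e = 1) (b : B) :
    quotientRep I hI b ∈ Submodule.span ℂ
      ((fun u : ((B ⧸ I) →L[ℂ] (B ⧸ I))ˣ => (u : (B ⧸ I) →L[ℂ] (B ⧸ I))) ''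
        quotientIsometries I hI he) := by
  set S := Submodule.span ℂ ((fun u : ((B ⧸ I) →L[ℂ] (B ⧸ I))ˣ => (u : (B ⧸ I) →L[ℂ] (B ⧸ I))) ''
        quotientIsometries I hI he)
  have hcont : Continuous (quotientRep I hI) :=
    continuous_of_cofinite_le_ker hIc ‹_› _ fun x hx => by
      rw [LinearMap.mem_ker]
      ext y
      obtain ⟨y, rfl⟩ := I.mkQ_surjective y
      exact (Submodule.Quotient.mk_eq_zero I).2 (hI y x hx).2
  have hS : IsClosed ((S.comap (quotientRep I hI) : Submodule ℂ B) : Set B) :=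
    (Submodule.closed_of_finiteDimensional S).preimage hcont
  have h1 : b * e ∈ S.comap (quotientRep I hI) := by
    refine Submodule.topologicalClosure_minimal _ (Submodule.span_le.2 ?_) hS (hU b e)
    rintro _ ⟨U, hU, rfl⟩
    obtain ⟨u, hu, hu'⟩ := quotientRep_multiplier_mem I hI hU hL he
    exact Submodule.subset_span ⟨u, hu, hu'⟩
  have h2 : quotientRep I hI b = quotientRep I hI (b * e) := by rw [quotientRep_mul, he, mul_one]
  rw [h2]
  exact h1

end

/-- In a Banach algebra with approximate units in which products are approximated by combinations
of translates under isometric multipliers, continuity of the derivations into finite-dimensional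
bimodules implies that the squares of closed cofinite ideals are closed and cofinite. -/
theorem squaresClosedCofinite_of_finiteDimDerivationsContinuous
    (hL : ∀ F : Finset B, ∀ ε > 0, ∃ e : B, ∀ b ∈ F, ‖e * b - b‖ < ε)
    (hR : ∀ b : B, ∀ ε > 0, ∃ e, ‖b * e - b‖ < ε)
    (hU : ∀ a b : B, a * b ∈
      (Submodule.span ℂ ((fun U : B ≃ₗᵢ[ℂ] B => U b) '' isometricLeftMultipliers B)).topologicalClosure)
    (hder : FiniteDimDerivationsContinuous.{u, w} B) : SquaresClosedCofinite B := by
  intro I hI hIc hcof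
  refine idealSq_isClosed_and_isCofinite hI hcof fun J hJ hJcof hsq hJI => ?_
  have : IsClosed (I : Set B) := hIc
  have : FiniteDimensional ℂ (B ⧸ I) := hcof
  obtain ⟨e, he⟩ := exists_quotientRep_eq_one I hI hL
  have := compactSpace_quotientIsometries I hI he
  have hmem : ∀ u ∈ quotientIsometries I hI he, ∃ b, quotientRep I hI b = u := fun u hu => hu.1.2
  exact isClosed_of_idealSq_le (E := (B ⧸ I) →L[ℂ] (B ⧸ I)) hder (quotientRep I hI)
    (quotientRep_mul I hI) (quotientIsometries I hI he) hmem (quotientRep_mem_span I hI hL hU he) hI hIc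
    hcof (quotientRep_eq_zero_iff I hI hR) hJ hJcof hsq hJI

end Multipliers

/-! ### Multipliers of a C⋆-algebra -/

section MultiplierAlgebra

variable {A : Type v} [NonUnitalCStarAlgebra A]

lemma eq_of_forall_mul_left_eq {a b : A} (h : ∀ c, c * a = c * b) : a = b := by
  rw [← sub_eq_zero, ← CStarRing.star_mul_self_eq_zero_iff, mul_sub, h, sub_self]

lemma eq_of_forall_mul_right_eq {a b : A} (h : ∀ c, a * c = b * c) : a = b := by
  rw [← sub_eq_zero, ← CStarRing.mul_star_self_eq_zero_iff, sub_mul, h, sub_self]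

namespace DoubleCentralizer

/-- Module linearity follows from centrality alone, since an element of a C⋆-algebra is determined
by its products with all others. -/
lemma fst_mul_right (u : 𝓜(ℂ, A)) (a b : A) : u.fst (a * b) = u.fst a * b :=
  eq_of_forall_mul_left_eq fun c => by rw [← u.central, ← mul_assoc, u.central, mul_assoc]

lemma snd_mul_left (u : 𝓜(ℂ, A)) (a b : A) : u.snd (a * b) = a * u.snd b :=
  eq_of_forall_mul_right_eq fun c => by rw [u.central, mul_assoc, mul_assoc, u.central]

lemma fst_snd_comm (u v : 𝓜(ℂ, A)) (a : A) : u.fst (v.snd a) = v.snd (u.fst a) :=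
  eq_of_forall_mul_left_eq fun c => by
    rw [← u.central, ← snd_mul_left, u.central, snd_mul_left]

lemma norm_unitary_le (u : unitary 𝓜(ℂ, A)) : ‖(u : 𝓜(ℂ, A))‖ ≤ 1 := by
  cases subsingleton_or_nontrivial 𝓜(ℂ, A)
  · simp [Subsingleton.elim (u : 𝓜(ℂ, A)) 0]
  · exact (CStarRing.norm_coe_unitary u).le

lemma norm_fst_unitary_apply (u : unitary 𝓜(ℂ, A)) (a : A) : ‖(u : 𝓜(ℂ, A)).fst a‖ = ‖a‖ := by
  have key : ∀ (u : unitary 𝓜(ℂ, A)) (a : A), ‖(u : 𝓜(ℂ, A)).fst a‖ ≤ ‖a‖ := fun u a =>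
    ((u : 𝓜(ℂ, A)).fst.le_opNorm a).trans (by
      rw [norm_fst]; exact mul_le_of_le_one_left (norm_nonneg _) (norm_unitary_le u))
  refine le_antisymm (key u a) ?_
  have h := key (star u) ((u : 𝓜(ℂ, A)).fst a)
  rwa [← mul_apply_eq_comp, ← mul_fst, Unitary.coe_star, Unitary.coe_star_mul_self,
    one_fst, one_apply_eq_self] at h

lemma norm_snd_unitary_apply (u : unitary 𝓜(ℂ, A)) (a : A) : ‖(u : 𝓜(ℂ, A)).snd a‖ = ‖a‖ := by
  have key : ∀ (u : unitary 𝓜(ℂ, A)) (a : A), ‖(u : 𝓜(ℂ, A)).snd a‖ ≤ ‖a‖ := fun u a =>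
    ((u : 𝓜(ℂ, A)).snd.le_opNorm a).trans (by
      rw [norm_snd]; exact mul_le_of_le_one_left (norm_nonneg _) (norm_unitary_le u))
  refine le_antisymm (key u a) ?_
  have h := key (star u) ((u : 𝓜(ℂ, A)).snd a)
  rwa [← mul_apply_eq_comp, ← mul_snd, Unitary.coe_mul_star_self,
    one_snd, one_apply_eq_self] at h

end DoubleCentralizer

end MultiplierAlgebra

/-! ### Joint continuity and the pointwise operators of a twisted action -/

lemma continuous_eval_of_norm_le {Y E F : Type*} [TopologicalSpace Y] [NormedAddCommGroup E]
    [NormedSpace ℂ E] [NormedAddCommGroup F] [NormedSpace ℂ F] {c : Y → E →L[ℂ] F} (C : ℝ)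
    (hC : ∀ y, ‖c y‖ ≤ C) (hc : ∀ a, Continuous fun y => c y a) :
    Continuous fun p : Y × E => c p.1 p.2 := by
  have h := continuous_prod_of_continuous_lipschitzWith (fun p : E × Y => c p.2 p.1) C.toNNReal hc
    fun y => LipschitzWith.of_dist_le_mul fun a b => by
      rw [dist_eq_norm, dist_eq_norm, ← map_sub]
      exact (c y).le_of_opNorm_le ((hC y).trans (Real.le_coe_toNNReal C)) _
  exact h.comp continuous_swap

namespace TwistedAction

open DoubleCentralizer

variable {G : Type u} {A : Type v} [Group G] [TopologicalSpace G] [NonUnitalCStarAlgebra A]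
  (T : TwistedAction G A)

lemma cocycle_apply (x y z : G) (a : A) :
    (T.ω x (y * z) : 𝓜(ℂ, A)).snd (T.α x ((T.ω y z : 𝓜(ℂ, A)).snd a)) =
      (T.ω (x * y) z : 𝓜(ℂ, A)).snd ((T.ω x y : 𝓜(ℂ, A)).snd (T.α x a)) := by
  have h := congrArg (fun u : 𝓜(ℂ, A) => u.snd (T.α x a)) (T.cocycle x y z)
  simpa [multiplierExtend, automorphismCLM] using h

lemma twist_apply (x y : G) (a : A) :
    (T.ω x y : 𝓜(ℂ, A)).snd (T.α x (T.α y a)) = (T.ω x y : 𝓜(ℂ, A)).fst (T.α (x * y) a) :=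
  eq_of_forall_mul_right_eq fun c => by
    have h := congrArg (fun u : 𝓜(ℂ, A) => u.fst c) (T.twist x y a)
    simp only [mul_fst, coe_fst, mul_apply_eq_comp, ContinuousLinearMap.mul_apply',
      fst_mul_right] at h
    rw [central, h]

/-- The operator `a ↦ α_y(a) ω(y, y⁻¹x)`. -/
noncomputable def cell (y x : G) : A →L[ℂ] A :=
  (T.ω y (y⁻¹ * x) : 𝓜(ℂ, A)).snd.comp (automorphismCLM (T.α y))

lemma cell_apply (y x : G) (a : A) :
    T.cell y x a = (T.ω y (y⁻¹ * x) : 𝓜(ℂ, A)).snd (T.α y a) := rfl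

lemma norm_cell_apply (y x : G) (a : A) : ‖T.cell y x a‖ = ‖a‖ := by
  rw [cell_apply, norm_snd_unitary_apply]
  exact (StarAlgEquiv.isometry (T.α y)).norm_map_of_map_zero (map_zero _) a

lemma norm_cell_le (y x : G) : ‖T.cell y x‖ ≤ 1 :=
  ContinuousLinearMap.opNorm_le_bound _ zero_le_one fun a => by rw [norm_cell_apply, one_mul]

lemma cell_mul (y x : G) (a b : A) : T.cell y x (a * b) = T.α y a * T.cell y x b := by
  rw [cell_apply, map_mul, snd_mul_left, cell_apply]

/-- The cocycle identity combined with the twisting relation; pointwise, this is the projective law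
`L_y L_z = ω(y, z) L_{yz}`. -/
lemma cell_cell (y z x : G) (a : A) :
    T.cell y x (T.cell z (y⁻¹ * x) a) = (T.ω y z : 𝓜(ℂ, A)).fst (T.cell (y * z) x a) := by
  simp only [cell_apply]
  have h := T.cocycle_apply y z (z⁻¹ * (y⁻¹ * x)) (T.α z a)
  rw [mul_inv_cancel_left] at h
  rw [h, twist_apply, fst_snd_comm, mul_inv_rev, mul_assoc]

lemma cell_one (x : G) (a : A) : T.cell 1 x a = a := by
  simp [cell_apply, T.ω_one_left, T.α_one]

lemma convIntegrand_eq (Φ Ψ : G → A) (x y : G) :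
    T.convIntegrand Φ Ψ x y = Φ y * T.cell y x (Ψ (y⁻¹ * x)) := by
  rw [convIntegrand, cell_apply, snd_mul_left]

variable [IsTopologicalGroup G]

lemma continuous_cell_uncurry :
    Continuous fun p : (G × G) × A => T.cell p.1.1 p.1.2 p.2 := by
  refine continuous_eval_of_norm_le (c := fun p : G × G => T.cell p.1 p.2) 1
    (fun p => T.norm_cell_le p.1 p.2) fun a => ?_
  have hsnd := continuous_eval_of_norm_le (c := fun p : G × G => (T.ω p.1 p.2 : 𝓜(ℂ, A)).snd) 1
    (fun p => by rw [norm_snd]; exact norm_unitary_le _) T.continuous_ω_right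
  have h3 : Continuous fun p : G × G => ((p.1, p.1⁻¹ * p.2), T.α p.1 a) :=
    (continuous_fst.prodMk (continuous_fst.inv.mul continuous_snd)).prodMk
      ((T.continuous_α a).comp continuous_fst)
  simp only [cell_apply]
  exact hsnd.comp h3

lemma continuous_cell {Y : Type*} [TopologicalSpace Y] {y x : Y → G} {f : Y → A}
    (hy : Continuous y) (hx : Continuous x) (hf : Continuous f) :
    Continuous fun t => T.cell (y t) (x t) (f t) :=
  T.continuous_cell_uncurry.comp ((hy.prodMk hx).prodMk hf)

end TwistedAction

open scoped Pointwise

/-! ### Approximation of integrable functions by compactly supported ones -/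

section Decomposition

section

variable {ι X E : Type*} [Countable ι] [MeasurableSpace X] {μ : Measure X} [NormedAddCommGroup E]
  {f : ι → X → E}

lemma lintegral_tsum_enorm_ne_top (hf : ∀ n, Integrable (f n) μ)
    (hs : Summable fun n => ∫ x, ‖f n x‖ ∂μ) : ∫⁻ x, ∑' n, ‖f n x‖ₑ ∂μ ≠ ⊤ := by
  rw [lintegral_tsum fun n => (hf n).1.enorm]
  have : ∀ n, ∫⁻ x, ‖f n x‖ₑ ∂μ = ENNReal.ofReal (∫ x, ‖f n x‖ ∂μ) := fun n =>
    (ofReal_integral_norm_eq_lintegral_enorm (hf n)).symm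
  simp_rw [this]
  exact hs.tsum_ofReal_ne_top

lemma ae_summable_norm_of_summable_integral_norm (hf : ∀ n, Integrable (f n) μ)
    (hs : Summable fun n => ∫ x, ‖f n x‖ ∂μ) : ∀ᵐ x ∂μ, Summable fun n => ‖f n x‖ := by
  have h2 := ae_lt_top' (AEMeasurable.tsum fun n => (hf n).1.enorm)
    (lintegral_tsum_enorm_ne_top hf hs)
  filter_upwards [h2] with x hx
  have : Summable fun n => ‖f n x‖₊ := by
    rw [← ENNReal.tsum_coe_ne_top_iff_summable]
    exact hx.ne
  exact NNReal.summable_coe.2 this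

end

variable {G : Type*} [TopologicalSpace G] [T2Space G] [LocallyCompactSpace G] [MeasurableSpace G]
  [BorelSpace G] {μ : Measure G} [μ.Regular] {E F : Type*}
  [NormedAddCommGroup E] [NormedSpace ℂ E] [NormedAddCommGroup F] [NormedSpace ℂ F]

/-- Density of the continuous functions with compact support in `L¹`, for a regular measure on a
locally compact space which need not be normal. -/
lemma MeasureTheory.Integrable.exists_continuous_hasCompactSupport {f : G → E}
    (hf : Integrable f μ) {ε : ℝ} (hε : 0 < ε) :
    ∃ g : G → E, HasCompactSupport g ∧ (∫ x, ‖f x - g x‖ ∂μ) ≤ ε ∧ Continuous g ∧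
      Integrable g μ := by
  have hε' : ENNReal.ofReal ε ≠ 0 := by simpa using hε
  suffices H : ∃ g : G → E, eLpNorm (f - g) 1 μ ≤ ENNReal.ofReal ε ∧
      (Continuous g ∧ HasCompactSupport g) by
    obtain ⟨g, h1, h2, h3⟩ := H
    have hg : Integrable g μ := h2.integrable_of_hasCompactSupport h3
    refine ⟨g, h3, ?_, h2, hg⟩
    rw [eLpNorm_one_eq_lintegral_enorm, ← ofReal_integral_norm_eq_lintegral_enorm (hf.sub hg)] at h1
    exact (ENNReal.ofReal_le_ofReal_iff hε.le).1 h1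
  refine (memLp_one_iff_integrable.2 hf).induction_dense ENNReal.one_ne_top _ ?_
    (fun f g hf hg => ⟨hf.1.add hg.1, hf.2.add hg.2⟩)
    (fun f hf => (hf.1.integrable_of_hasCompactSupport hf.2).aestronglyMeasurable) hε'
  intro c t ht htμ δ hδ
  obtain ⟨η, ηpos, hη⟩ := exists_eLpNorm_indicator_le (μ := μ) ENNReal.one_ne_top c hδ
  have hη' : ((η / 2 : NNReal) : ENNReal) ≠ 0 := by
    have := ηpos.ne'
    simp [this]
  obtain ⟨K, hKt, hK, hKc, hKμ⟩ := ht.exists_isCompact_isClosed_sdiff_lt htμ.ne hη'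
  -- The bump is `1` on `K` and `0` off `U`, so it differs from the indicator of `t` only on `(U \
  -- K) ∪ (t \ K)`. The open set `U` need not contain `t`.
  obtain ⟨U, hKU, hU, -, hUμ⟩ := hKc.measurableSet.exists_isOpen_sdiff_lt
    ((measure_mono hKt).trans_lt htμ).ne hη'
  obtain ⟨g, hg1, hg2, hg3, hg4⟩ := exists_continuousMap_one_of_isCompact_subset_isOpen hK hU hKU
  refine ⟨fun x => (g x : ℂ) • c, ?_, by fun_prop, ?_⟩
  · refine (eLpNorm_mono (g := ((U \ K) ∪ (t \ K)).indicator fun _ => c) fun x => ?_).trans (hη _ ?_)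
    · by_cases hxK : x ∈ K
      · simp [hg1 hxK, hKt hxK]
      · by_cases hxt : x ∈ t
        · have h1 : ((g x : ℂ) • c) - c = (((g x - 1 : ℝ)) : ℂ) • c := by
            push_cast
            rw [sub_smul, one_smul]
          have h2 : |g x - 1| ≤ 1 := abs_le.2 ⟨by linarith [(hg4 x).1], by linarith [(hg4 x).2]⟩
          simp only [Pi.sub_apply, Set.indicator_of_mem hxt, h1, norm_smul, Complex.norm_real]
          rw [Set.indicator_of_mem (show x ∈ (U \ K) ∪ (t \ K) from Or.inr ⟨hxt, hxK⟩)]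
          exact mul_le_of_le_one_left (norm_nonneg _) h2
        · by_cases hxU : x ∈ U
          · have h2 : |g x| ≤ 1 := abs_le.2 ⟨by linarith [(hg4 x).1], by linarith [(hg4 x).2]⟩
            simp only [Pi.sub_apply, Set.indicator_of_notMem hxt, sub_zero, norm_smul,
              Complex.norm_real]
            rw [Set.indicator_of_mem (show x ∈ (U \ K) ∪ (t \ K) from Or.inl ⟨hxU, hxK⟩)]
            exact mul_le_of_le_one_left (norm_nonneg _) h2
          · have h2 : g x = 0 := image_eq_zero_of_notMem_tsupport fun h => hxU (hg3 h)
            simp [hxt, h2]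
    · refine (measure_union_le _ _).trans ((add_le_add hUμ.le hKμ.le).trans ?_)
      rw [← ENNReal.coe_add, add_halves]
  · exact HasCompactSupport.mono (f := g) hg2 fun x hx h => hx (by simp [h])

/-- An integrable function is the sum of an absolutely convergent series in `L¹` of continuous
functions with compact support. -/
lemma MeasureTheory.Integrable.exists_series {f : G → E} (hf : Integrable f μ) :
    ∃ g : ℕ → G → E, (∀ n, Continuous (g n)) ∧ (∀ n, HasCompactSupport (g n)) ∧
      (Summable fun n => ∫ x, ‖g n x‖ ∂μ) ∧
      ∀ᵐ x ∂μ, (Summable fun n => ‖g n x‖) ∧ HasSum (fun n => g n x) (f x) := by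
  have hpos : ∀ n : ℕ, (0 : ℝ) < (1 / 2) ^ n := fun n => by positivity
  choose k hks hkf hkc hki using fun n => hf.exists_continuous_hasCompactSupport (hpos n)
  -- Telescoping differences of approximants with error `(1/2)^n`. Consecutive errors add up to at
  -- most `2 (1/2)^n`, and summability of the errors forces `k n → f` almost everywhere.
  let g : ℕ → G → E := fun n => n.casesOn (k 0) fun m => k (m + 1) - k m
  have hg0 : g 0 = k 0 := rfl
  have hgs : ∀ m, g (m + 1) = k (m + 1) - k m := fun m => rfl
  have hgc : ∀ n, Continuous (g n) := fun n => by
    cases n with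
    | zero => exact hkc 0
    | succ m => exact (hkc (m + 1)).sub (hkc m)
  have hgk : ∀ n, HasCompactSupport (g n) := fun n => by
    cases n with
    | zero => exact hks 0
    | succ m => exact (hks (m + 1)).sub (hks m)
  have hgi : ∀ n, Integrable (g n) μ := fun n =>
    (hgc n).integrable_of_hasCompactSupport (hgk n)
  have hsum : Summable fun n => ∫ x, ‖g n x‖ ∂μ := by
    rw [← summable_nat_add_iff 1]
    refine Summable.of_nonneg_of_le (fun n => integral_nonneg fun x => norm_nonneg _) (fun n => ?_)
      ((summable_geometric_of_lt_one (by norm_num) (by norm_num : (1 / 2 : ℝ) < 1)).mul_left 2)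
    have h1 : ∫ x, ‖g (n + 1) x‖ ∂μ ≤ ∫ x, (‖f x - k (n + 1) x‖ + ‖f x - k n x‖) ∂μ := by
      refine integral_mono (hgi (n + 1)).norm
        ((hf.sub (hki (n + 1))).norm.add (hf.sub (hki n)).norm) fun x => ?_
      change ‖g (n + 1) x‖ ≤ ‖f x - k (n + 1) x‖ + ‖f x - k n x‖
      rw [hgs, Pi.sub_apply, ← norm_neg (f x - k (n + 1) x)]
      refine le_trans (le_of_eq ?_) (norm_add_le _ _)
      congr 1
      abel
    have h0 := integral_add (hf.sub (hki (n + 1))).norm (hf.sub (hki n)).norm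
    simp only [Pi.sub_apply] at h0
    rw [h0] at h1
    have h2 := hkf (n + 1)
    have h3 := hkf n
    have h4 : (1 / 2 : ℝ) ^ (n + 1) ≤ (1 / 2) ^ n := pow_le_pow_of_le_one (by norm_num) (by norm_num)
      (Nat.le_succ n)
    linarith
  have hdiff : Summable fun n => ∫ x, ‖(f - k n) x‖ ∂μ :=
    Summable.of_nonneg_of_le (fun n => integral_nonneg fun x => norm_nonneg _) hkf
      (summable_geometric_of_lt_one (by norm_num) (by norm_num : (1 / 2 : ℝ) < 1))
  refine ⟨g, hgc, hgk, hsum, ?_⟩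
  filter_upwards [ae_summable_norm_of_summable_integral_norm hgi hsum,
    ae_summable_norm_of_summable_integral_norm (fun n => hf.sub (hki n)) hdiff] with x h1 h2
  refine ⟨h1, ?_⟩
  have hpart : ∀ n, ∑ i ∈ Finset.range (n + 1), g i x = k n x := fun n => by
    induction n with
    | zero => simp [hg0]
    | succ n ih => rw [Finset.sum_range_succ, ih, hgs]; simp
  have hlim : Filter.Tendsto (fun n => k n x) Filter.atTop (nhds (f x)) := by
    rw [tendsto_iff_norm_sub_tendsto_zero]
    refine h2.tendsto_atTop_zero.congr fun n => ?_
    rw [Pi.sub_apply, norm_sub_rev]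
  refine (hasSum_iff_tendsto_nat_of_summable_norm h1).2 ?_
  rw [← Filter.tendsto_add_atTop_iff_nat 1]
  exact hlim.congr fun n => (hpart n).symm

/-- A merely strongly continuous operator family need not be norm measurable. Measurability of the
result is checked on continuous compactly supported functions and passes to series. -/
lemma integrable_clm_apply {c : G → E →L[ℂ] F} (C : ℝ) (hC : ∀ x, ‖c x‖ ≤ C)
    (hc : ∀ a, Continuous fun x => c x a) {f : G → E} (hf : Integrable f μ) :
    Integrable (fun x => c x (f x)) μ := by
  have hcont := continuous_eval_of_norm_le C hC hc
  obtain ⟨g, hg, hgs, -, hae⟩ := hf.exists_series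
  have hm : ∀ n, AEStronglyMeasurable (fun x => c x (g n x)) μ := fun n => by
    refine (Continuous.integrable_of_hasCompactSupport ?_ ?_).aestronglyMeasurable
    · exact hcont.comp (continuous_id.prodMk (hg n))
    · exact (hgs n).mono fun x hx h => hx (by simp [h])
  have hmeas : AEStronglyMeasurable (fun x => c x (f x)) μ := by
    refine aestronglyMeasurable_of_tendsto_ae Filter.atTop
      (f := fun n x => ∑ i ∈ Finset.range n, c x (g i x))
      (fun n => Finset.aestronglyMeasurable_fun_sum _ fun i _ => hm i) ?_
    filter_upwards [hae] with x hx
    simpa using ((c x).hasSum hx.2).tendsto_sum_nat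
  refine (hf.norm.const_mul C).mono' hmeas (Filter.Eventually.of_forall fun x => ?_)
  exact (c x).le_of_opNorm_le (hC x) _

end Decomposition

/-! ### Twisted translations and the convolution as a Bochner integral in `L¹` -/

section Translation

namespace TwistedAction

variable {G : Type u} {A : Type v} [Group G] [TopologicalSpace G] [IsTopologicalGroup G]
  [LocallyCompactSpace G] [T2Space G] [MeasurableSpace G] [BorelSpace G] [NonUnitalCStarAlgebra A]
  (T : TwistedAction G A) (μ : Measure G) [μ.IsHaarMeasure] [μ.Regular]

variable {μ} in
lemma integrable_cell_translate (y : G) {f : G → A} (hf : Integrable f μ) :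
    Integrable (fun x => T.cell y x (f (y⁻¹ * x))) μ :=
  integrable_clm_apply 1 (T.norm_cell_le y)
    (fun _ => T.continuous_cell continuous_const continuous_id continuous_const)
    (hf.comp_mul_left y⁻¹)

variable {μ} in
lemma ae_comp_inv_mul {p : G → Prop} (h : ∀ᵐ x ∂μ, p x) (y : G) : ∀ᵐ x ∂μ, p (y⁻¹ * x) :=
  (measurePreserving_mul_left μ y⁻¹).quasiMeasurePreserving.ae h

/-- The twisted translation `(L_y f)(x) = α_y(f(y⁻¹x)) ω(y, y⁻¹x)` on `L¹(G, A)`. -/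
noncomputable def translate (y : G) : Lp A 1 μ →ₗᵢ[ℂ] Lp A 1 μ where
  toFun f := (T.integrable_cell_translate y (L1.integrable_coeFn f)).toL1 _
  map_add' f g := by
    rw [← Integrable.toL1_add]
    refine (Integrable.toL1_eq_toL1_iff _ _ _ _).2 ?_
    filter_upwards [ae_comp_inv_mul (Lp.coeFn_add f g) y] with x hx
    rw [hx, Pi.add_apply, map_add, Pi.add_apply]
  map_smul' c f := by
    rw [RingHom.id_apply, ← Integrable.toL1_smul]
    refine (Integrable.toL1_eq_toL1_iff _ _ _ _).2 ?_
    filter_upwards [ae_comp_inv_mul (Lp.coeFn_smul c f) y] with x hx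
    rw [hx, Pi.smul_apply, map_smul]
  norm_map' f := by
    change ‖(T.integrable_cell_translate y (L1.integrable_coeFn f)).toL1 _‖ = _
    rw [L1.norm_of_fun_eq_integral_norm (T.integrable_cell_translate y (L1.integrable_coeFn f)),
      L1.norm_eq_integral_norm]
    simp_rw [norm_cell_apply]
    exact integral_mul_left_eq_self (fun x => ‖f x‖) y⁻¹

lemma translate_ae (y : G) (f : Lp A 1 μ) :
    T.translate μ y f =ᵐ[μ] fun x => T.cell y x (f (y⁻¹ * x)) :=
  (T.integrable_cell_translate y (L1.integrable_coeFn f)).coeFn_toL1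

/-- Left multiplication by a multiplier on `L¹(G, A)`. -/
noncomputable def multiplierMul (_T : TwistedAction G A) (v : 𝓜(ℂ, A)) : Lp A 1 μ →L[ℂ] Lp A 1 μ := v.fst.compLpL 1 μ

lemma multiplierMul_ae (v : 𝓜(ℂ, A)) (f : Lp A 1 μ) :
    T.multiplierMul μ v f =ᵐ[μ] fun x => v.fst (f x) :=
  v.fst.coeFn_compLpL f

/-- Left multiplication by an element of `A` on `L¹(G, A)`. -/
noncomputable def coeffMul (_T : TwistedAction G A) : A →L[ℂ] Lp A 1 μ →L[ℂ] Lp A 1 μ :=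
  (ContinuousLinearMap.mul ℂ A).compLpL₂ 1 μ

lemma coeffMul_ae (a : A) (f : Lp A 1 μ) : T.coeffMul μ a f =ᵐ[μ] fun x => a * f x :=
  ((ContinuousLinearMap.mul ℂ A) a).coeFn_compLp f

lemma norm_coeffMul_le (a : A) (f : Lp A 1 μ) : ‖T.coeffMul μ a f‖ ≤ ‖a‖ * ‖f‖ := by
  have h1 : ‖T.coeffMul μ‖ ≤ 1 := (ContinuousLinearMap.norm_compLpL₂_le _).trans
    (ContinuousLinearMap.opNorm_mul_le ℂ A)
  refine ((T.coeffMul μ).le_opNorm₂ a f).trans ?_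
  rw [mul_assoc]
  exact mul_le_of_le_one_left (by positivity) h1

lemma coeffMul_eq_multiplierMul (a : A) : T.coeffMul μ a = T.multiplierMul μ (a : 𝓜(ℂ, A)) := by
  ext f : 2
  filter_upwards [T.coeffMul_ae μ a f, T.multiplierMul_ae μ a f] with x h1 h2
  rw [h1, h2]
  simp

lemma multiplierMul_multiplierMul (v w : 𝓜(ℂ, A)) (f : Lp A 1 μ) :
    T.multiplierMul μ v (T.multiplierMul μ w f) = T.multiplierMul μ (v * w) f := by
  ext1
  filter_upwards [T.multiplierMul_ae μ v (T.multiplierMul μ w f), T.multiplierMul_ae μ w f,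
    T.multiplierMul_ae μ (v * w) f] with x h1 h2 h3
  rw [h1, h2, h3]
  rfl

lemma multiplierMul_one (f : Lp A 1 μ) : T.multiplierMul μ 1 f = f := by
  ext1
  filter_upwards [T.multiplierMul_ae μ 1 f] with x h1
  rw [h1]
  rfl

lemma multiplierMul_coeffMul (v : 𝓜(ℂ, A)) (a : A) (f : Lp A 1 μ) :
    T.multiplierMul μ v (T.coeffMul μ a f) = T.coeffMul μ (v.fst a) f := by
  ext1
  filter_upwards [T.multiplierMul_ae μ v (T.coeffMul μ a f), T.coeffMul_ae μ a f,
    T.coeffMul_ae μ (v.fst a) f] with x h1 h2 h3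
  rw [h1, h2, h3, DoubleCentralizer.fst_mul_right]

lemma coeffMul_multiplierMul (a : A) (v : 𝓜(ℂ, A)) (f : Lp A 1 μ) :
    T.coeffMul μ a (T.multiplierMul μ v f) = T.coeffMul μ (v.snd a) f := by
  ext1
  filter_upwards [T.coeffMul_ae μ a (T.multiplierMul μ v f), T.multiplierMul_ae μ v f,
    T.coeffMul_ae μ (v.snd a) f] with x h1 h2 h3
  rw [h1, h2, h3, v.central]

lemma translate_translate (y z : G) (f : Lp A 1 μ) :
    T.translate μ y (T.translate μ z f) =
      T.multiplierMul μ (T.ω y z) (T.translate μ (y * z) f) := by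
  ext1
  filter_upwards [T.translate_ae μ y (T.translate μ z f),
    ae_comp_inv_mul (T.translate_ae μ z f) y, T.translate_ae μ (y * z) f,
    T.multiplierMul_ae μ (T.ω y z) (T.translate μ (y * z) f)] with x h1 h2 h3 h4
  rw [h1, h2, h4, h3, cell_cell, mul_inv_rev, mul_assoc]

lemma translate_one (f : Lp A 1 μ) : T.translate μ 1 f = f := by
  ext1
  filter_upwards [T.translate_ae μ 1 f] with x h1
  rw [h1, cell_one, inv_one, one_mul]

lemma translate_coeffMul (y : G) (a : A) (f : Lp A 1 μ) :
    T.translate μ y (T.coeffMul μ a f) = T.coeffMul μ (T.α y a) (T.translate μ y f) := by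
  ext1
  filter_upwards [T.translate_ae μ y (T.coeffMul μ a f), ae_comp_inv_mul (T.coeffMul_ae μ a f) y,
    T.coeffMul_ae μ (T.α y a) (T.translate μ y f), T.translate_ae μ y f] with x h1 h2 h3 h4
  rw [h1, h2, h3, h4, cell_mul]

lemma exists_norm_sub_lt (f : Lp A 1 μ) {ε : ℝ} (hε : 0 < ε) : ∃ (g : G → A) (_ : Continuous g)
    (_ : HasCompactSupport g) (hi : Integrable g μ), ‖f - hi.toL1 g‖ < ε := by
  obtain ⟨g, hg1, hg2, hg3, hg4⟩ :=
    (L1.integrable_coeFn f).exists_continuous_hasCompactSupport (half_pos hε)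
  refine ⟨g, hg3, hg1, hg4, lt_of_le_of_lt ?_ (half_lt_self hε)⟩
  rw [L1.norm_eq_integral_norm]
  refine (integral_congr_ae ?_).le.trans hg2
  filter_upwards [Lp.coeFn_sub f (hg4.toL1 g), hg4.coeFn_toL1] with x h1 h2
  rw [h1, Pi.sub_apply, h2]

/-- For `y` in a compact neighbourhood `K` of `y₀`, the `L¹` distance to the translate at `y₀` is
the integral of a jointly continuous function supported in `K * tsupport f`, hence continuous in
`y`. -/
lemma continuous_translate_of_hasCompactSupport {f : G → A} (hf : Continuous f)
    (hs : HasCompactSupport f) (hi : Integrable f μ) :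
    Continuous fun y => T.translate μ y (hi.toL1 f) := by
  rw [continuous_iff_continuousAt]
  intro y₀
  obtain ⟨K, hK, hKy⟩ := exists_compact_mem_nhds y₀
  have hnorm : ∀ y, ‖T.translate μ y (hi.toL1 f) - T.translate μ y₀ (hi.toL1 f)‖ =
      ∫ x, ‖T.cell y x (f (y⁻¹ * x)) - T.cell y₀ x (f (y₀⁻¹ * x))‖ ∂μ := by
    intro y
    rw [L1.norm_eq_integral_norm]
    refine integral_congr_ae ?_
    filter_upwards [Lp.coeFn_sub (T.translate μ y (hi.toL1 f)) (T.translate μ y₀ (hi.toL1 f)),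
      T.translate_ae μ y (hi.toL1 f), T.translate_ae μ y₀ (hi.toL1 f),
      ae_comp_inv_mul hi.coeFn_toL1 y, ae_comp_inv_mul hi.coeFn_toL1 y₀] with x h1 h2 h3 h4 h5
    rw [h1, Pi.sub_apply, h2, h3, h4, h5]
  have hzero : ∀ p ∈ K, ∀ x, x ∉ K * tsupport f → f (p⁻¹ * x) = 0 := fun p hp x hx => by
    refine image_eq_zero_of_notMem_tsupport fun h => hx ?_
    exact ⟨p, hp, p⁻¹ * x, h, mul_inv_cancel_left p x⟩
  have hcont : ContinuousOn (fun y => ∫ x, ‖T.cell y x (f (y⁻¹ * x)) -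
      T.cell y₀ x (f (y₀⁻¹ * x))‖ ∂μ) K := by
    refine continuousOn_integral_of_compact_support (hK.mul hs) (Continuous.continuousOn ?_) ?_
    · refine ((T.continuous_cell continuous_fst continuous_snd
        (hf.comp (continuous_fst.inv.mul continuous_snd))).sub
        (T.continuous_cell continuous_const continuous_snd
        (hf.comp (continuous_const.mul continuous_snd)))).norm
    · intro p x hp hx
      rw [hzero p hp x hx, hzero y₀ (mem_of_mem_nhds hKy) x hx]
      simp
  have h := (hcont.continuousAt hKy).tendsto
  simp_rw [← hnorm, sub_self, norm_zero] at h
  exact tendsto_iff_norm_sub_tendsto_zero.2 h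

lemma continuous_translate (f : Lp A 1 μ) : Continuous fun y => T.translate μ y f := by
  refine continuous_of_uniform_approx_of_continuous fun u hu => ?_
  obtain ⟨ε, hε, hu⟩ := Metric.mem_uniformity_dist.1 hu
  obtain ⟨g, hg, hgs, hgi, hfg⟩ := exists_norm_sub_lt μ f hε
  refine ⟨_, T.continuous_translate_of_hasCompactSupport μ hg hgs hgi, fun y => hu ?_⟩
  rwa [(T.translate μ y).dist_map, dist_eq_norm]

/-- For fixed `g`, the strongly continuous family `a ↦ a (L_y g)`. -/
noncomputable def productFamily (g : Lp A 1 μ) (y : G) : A →L[ℂ] Lp A 1 μ :=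
  (T.coeffMul μ).flip (T.translate μ y g)

lemma productFamily_apply (g : Lp A 1 μ) (y : G) (a : A) :
    T.productFamily μ g y a = T.coeffMul μ a (T.translate μ y g) := rfl

lemma norm_productFamily_le (g : Lp A 1 μ) (y : G) : ‖T.productFamily μ g y‖ ≤ ‖g‖ := by
  refine ContinuousLinearMap.opNorm_le_bound _ (norm_nonneg _) fun a => ?_
  rw [productFamily_apply, mul_comm]
  exact (T.norm_coeffMul_le μ a _).trans_eq (by rw [LinearIsometry.norm_map])

variable {μ} in
lemma integrable_productFamily (g : Lp A 1 μ) {f : G → A} (hf : Integrable f μ) :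
    Integrable (fun y => T.coeffMul μ (f y) (T.translate μ y g)) μ :=
  integrable_clm_apply ‖g‖ (T.norm_productFamily_le μ g)
    (fun a => (T.coeffMul μ a).continuous.comp (T.continuous_translate μ g)) hf

/-- The twisted convolution as a bounded bilinear map on `L¹(G, A)`. -/
noncomputable def convL1 : Lp A 1 μ →L[ℂ] Lp A 1 μ →L[ℂ] Lp A 1 μ :=
  LinearMap.mkContinuous₂
    (LinearMap.mk₂ ℂ (fun f g => ∫ y, T.coeffMul μ (f y) (T.translate μ y g) ∂μ)
      (fun f f' g => by
        rw [← integral_add (T.integrable_productFamily g (L1.integrable_coeFn f))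
          (T.integrable_productFamily g (L1.integrable_coeFn f'))]
        refine integral_congr_ae ?_
        filter_upwards [Lp.coeFn_add f f'] with y hy
        rw [hy, Pi.add_apply, map_add, add_apply])
      (fun c f g => by
        rw [← integral_smul]
        refine integral_congr_ae ?_
        filter_upwards [Lp.coeFn_smul c f] with y hy
        rw [hy, Pi.smul_apply, map_smul, smul_apply])
      (fun f g g' => by
        rw [← integral_add (T.integrable_productFamily g (L1.integrable_coeFn f))
          (T.integrable_productFamily g' (L1.integrable_coeFn f))]
        simp_rw [map_add])
      (fun c f g => by
        rw [← integral_smul]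
        simp_rw [map_smul])) 1
    (fun f g => by
      change ‖∫ y, T.coeffMul μ (f y) (T.translate μ y g) ∂μ‖ ≤ _
      rw [one_mul, L1.norm_eq_integral_norm f, ← integral_mul_const]
      refine norm_integral_le_of_norm_le ((L1.integrable_coeFn f).norm.mul_const _)
        (Filter.Eventually.of_forall fun y => ?_)
      exact (T.norm_coeffMul_le μ _ _).trans_eq (by rw [LinearIsometry.norm_map]))

lemma convL1_apply (f g : Lp A 1 μ) :
    T.convL1 μ f g = ∫ y, T.coeffMul μ (f y) (T.translate μ y g) ∂μ := rfl

lemma norm_convL1_le (f g : Lp A 1 μ) : ‖T.convL1 μ f g‖ ≤ ‖f‖ * ‖g‖ := by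
  refine ((T.convL1 μ).le_opNorm₂ f g).trans ?_
  rw [mul_assoc]
  exact mul_le_of_le_one_left (by positivity) (LinearMap.mkContinuous₂_norm_le _ zero_le_one _)

variable {μ} in
lemma convL1_toL1 {f : G → A} (hf : Integrable f μ) (g : Lp A 1 μ) :
    T.convL1 μ (hf.toL1 f) g = ∫ y, T.coeffMul μ (f y) (T.translate μ y g) ∂μ := by
  refine integral_congr_ae ?_
  filter_upwards [hf.coeFn_toL1] with y hy
  rw [hy]

lemma multiplierMul_convL1 (v : 𝓜(ℂ, A)) (f g : Lp A 1 μ) :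
    T.multiplierMul μ v (T.convL1 μ f g) = T.convL1 μ (T.multiplierMul μ v f) g := by
  rw [convL1_apply, convL1_apply, ← ContinuousLinearMap.integral_comp_comm _
    (T.integrable_productFamily g (L1.integrable_coeFn f))]
  refine integral_congr_ae ?_
  filter_upwards [T.multiplierMul_ae μ v f] with y hy
  rw [hy, multiplierMul_coeffMul]

lemma coeffMul_convL1 (a : A) (f g : Lp A 1 μ) :
    T.coeffMul μ a (T.convL1 μ f g) = T.convL1 μ (T.coeffMul μ a f) g := by
  rw [coeffMul_eq_multiplierMul, multiplierMul_convL1]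

/-- Moving `L_y` inside the integral yields `α_y(f(z)) ω(y, z) L_{yz} g`. After the substitution `z
↦ y⁻¹ z`, the coefficient is exactly `(L_y f)(z)`. -/
lemma translate_convL1 (y : G) (f g : Lp A 1 μ) :
    T.translate μ y (T.convL1 μ f g) = T.convL1 μ (T.translate μ y f) g := by
  rw [convL1_apply, convL1_apply]
  change (T.translate μ y).toContinuousLinearMap _ = _
  rw [← ContinuousLinearMap.integral_comp_comm _
    (T.integrable_productFamily g (L1.integrable_coeFn f)),
    ← integral_mul_left_eq_self _ y⁻¹]
  refine integral_congr_ae ?_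
  filter_upwards [T.translate_ae μ y f] with z hz
  rw [hz]
  change T.translate μ y _ = _
  rw [translate_coeffMul, translate_translate, coeffMul_multiplierMul, mul_inv_cancel_left]
  rfl

/-- Integrating `(f(y) L_y g) * h = f(y) L_y (g * h)` over `y` suffices, so no interchange of
integrals is needed. -/
lemma convL1_assoc (f g h : Lp A 1 μ) :
    T.convL1 μ (T.convL1 μ f g) h = T.convL1 μ f (T.convL1 μ g h) := by
  have h1 := ((T.convL1 μ).flip h).integral_comp_comm
    (T.integrable_productFamily g (L1.integrable_coeFn f))
  rw [← T.convL1_apply μ f g, ContinuousLinearMap.flip_apply] at h1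
  rw [← h1, T.convL1_apply μ f (T.convL1 μ g h)]
  congr 1
  ext1 y
  rw [ContinuousLinearMap.flip_apply, translate_convL1, coeffMul_convL1]

end TwistedAction

end Translation

/-! ### Double series and termwise integration -/

section Series

variable {ι κ : Type*}

lemma hasSum_bilinear {E F H : Type*} [NormedAddCommGroup E] [NormedSpace ℂ E]
    [NormedAddCommGroup F] [NormedSpace ℂ F] [NormedAddCommGroup H] [NormedSpace ℂ H]
    [CompleteSpace H] (L : E →L[ℂ] F →L[ℂ] H) {a : ι → E} {b : κ → F} {x : E} {y : F}
    (ha : HasSum a x) (ha' : Summable fun i => ‖a i‖) (hb : HasSum b y)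
    (hb' : Summable fun i => ‖b i‖) : HasSum (fun p : ι × κ => L (a p.1) (b p.2)) (L x y) := by
  have hs : Summable fun p : ι × κ => L (a p.1) (b p.2) := by
    refine Summable.of_norm_bounded (g := fun p : ι × κ => ‖L‖ * (‖a p.1‖ * ‖b p.2‖)) ?_ fun p => ?_
    · exact (ha'.mul_of_nonneg hb' (fun _ => norm_nonneg _) fun _ => norm_nonneg _).mul_left _
    · rw [← mul_assoc]
      exact L.le_opNorm₂ _ _
  obtain ⟨s, hs⟩ := hs
  have h1 : HasSum (fun i => L (a i) y) s := hs.prod_fiberwise fun i => (L (a i)).hasSum hb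
  have h2 : HasSum (fun i => L (a i) y) (L x y) := (L.flip y).hasSum ha
  rwa [h1.unique h2] at hs

variable [Countable ι] {X E : Type*} [MeasurableSpace X] {μ : Measure X} [NormedAddCommGroup E]
  {f : ι → X → E} {g : X → E}

lemma integrable_of_hasSum (hf : ∀ n, Integrable (f n) μ)
    (hs : Summable fun n => ∫ x, ‖f n x‖ ∂μ) (hg : ∀ᵐ x ∂μ, HasSum (fun n => f n x) (g x)) :
    Integrable g μ := by
  refine ⟨aestronglyMeasurable_of_tendsto_ae (Filter.atTop : Filter (Finset ι))
    (f := fun s x => ∑ i ∈ s, f i x)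
    (fun s => Finset.aestronglyMeasurable_fun_sum _ fun i _ => (hf i).1) hg, ?_⟩
  refine lt_of_le_of_lt (lintegral_mono_ae ?_) (lintegral_tsum_enorm_ne_top hf hs).lt_top
  filter_upwards [hg, ae_summable_norm_of_summable_integral_norm hf hs] with x h1 h2
  rw [← h1.tsum_eq]
  exact enorm_tsum_le_tsum_enorm

variable [NormedSpace ℂ E] [CompleteSpace E]

lemma hasSum_integral_of_hasSum (hf : ∀ n, Integrable (f n) μ)
    (hs : Summable fun n => ∫ x, ‖f n x‖ ∂μ) (hg : ∀ᵐ x ∂μ, HasSum (fun n => f n x) (g x)) :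
    HasSum (fun n => ∫ x, f n x ∂μ) (∫ x, g x ∂μ) := by
  have h := hasSum_integral_of_summable_integral_norm hf hs
  rwa [integral_congr_ae (hg.mono fun x hx => hx.tsum_eq)] at h

variable (μ) in
/-- Integration over a set as a bounded operator on `L¹`. -/
noncomputable def setIntegralL1 (s : Set X) : Lp E 1 μ →L[ℂ] E where
  toFun f := ∫ x in s, f x ∂μ
  map_add' f g := by
    rw [← integral_add (L1.integrable_coeFn f).integrableOn (L1.integrable_coeFn g).integrableOn]
    exact integral_congr_ae (ae_restrict_of_ae (Lp.coeFn_add f g))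
  map_smul' c f := by
    rw [RingHom.id_apply, ← integral_smul]
    exact integral_congr_ae (ae_restrict_of_ae (Lp.coeFn_smul c f))
  cont := continuous_setIntegral s

lemma setIntegralL1_toL1 (s : Set X) {h : X → E} (hh : Integrable h μ) :
    setIntegralL1 μ s (hh.toL1 h) = ∫ x in s, h x ∂μ :=
  integral_congr_ae (ae_restrict_of_ae hh.coeFn_toL1)

/-- Absolute convergence gives some limit in `L¹`; it is identified with `g` by comparing integrals
over measurable sets. -/
lemma hasSum_toL1 (hf : ∀ n, Integrable (f n) μ) (hs : Summable fun n => ∫ x, ‖f n x‖ ∂μ)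
    (hg : ∀ᵐ x ∂μ, HasSum (fun n => f n x) (g x)) :
    HasSum (fun n => (hf n).toL1 (f n)) ((integrable_of_hasSum hf hs hg).toL1 g) := by
  have hsum : Summable fun n => (hf n).toL1 (f n) := by
    refine Summable.of_norm ?_
    simpa only [L1.norm_of_fun_eq_integral_norm] using hs
  obtain ⟨G, hG⟩ := hsum
  convert! hG
  ext1
  refine (Integrable.coeFn_toL1 _).trans ?_
  refine Integrable.ae_eq_of_forall_setIntegral_eq _ _ (integrable_of_hasSum hf hs hg)
    (L1.integrable_coeFn G) fun s hs' _ => ?_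
  have h1 := (setIntegralL1 μ s).hasSum hG
  have h2 : HasSum (fun n => ∫ x in s, f n x ∂μ) (∫ x in s, g x ∂μ) := by
    refine hasSum_integral_of_hasSum (fun n => (hf n).integrableOn) ?_ (ae_restrict_of_ae hg)
    exact Summable.of_nonneg_of_le (fun n => integral_nonneg fun x => norm_nonneg _)
      (fun n => setIntegral_le_integral (hf n).norm (Filter.Eventually.of_forall fun x =>
        norm_nonneg _)) hs
  simp_rw [setIntegralL1_toL1] at h1
  exact h2.unique h1

end Series

/-! ### Null sets under inversion -/

section InverseNull

variable {G : Type u} [Group G] [TopologicalSpace G] [IsTopologicalGroup G]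
  [LocallyCompactSpace G] [T2Space G] [MeasurableSpace G] [BorelSpace G]
  (μ : Measure G) [μ.IsHaarMeasure] [μ.Regular]

lemma hasCompactSupport_uncurry_inv_mul {E : Type*} [Zero E] {F : G → G → E} {K L : Set G}
    (hK : IsCompact K) (hL : IsCompact L) (hF : ∀ y x, F y x ≠ 0 → y ∈ K ∧ y⁻¹ * x ∈ L) :
    HasCompactSupport F.uncurry := by
  refine HasCompactSupport.intro (hK.prod (hK.mul hL)) ?_
  rintro ⟨y, x⟩ hyx
  by_contra h
  obtain ⟨h1, h2⟩ := hF y x h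
  exact hyx ⟨h1, y, h1, y⁻¹ * x, h2, mul_inv_cancel_left y x⟩

lemma continuous_hasCompactSupport_integral {E : Type*} [NormedAddCommGroup E] [NormedSpace ℝ E]
    {F : G → G → E} (hF : Continuous F.uncurry) (hs : HasCompactSupport F.uncurry) :
    Continuous (fun x => ∫ y, F y x ∂μ) ∧ HasCompactSupport fun x => ∫ y, F y x ∂μ := by
  have hzero : ∀ y x, (y ∉ Prod.fst '' tsupport F.uncurry ∨ x ∉ Prod.snd '' tsupport F.uncurry) →
      F y x = 0 := by
    intro y x h
    have : (y, x) ∉ tsupport F.uncurry := fun h' =>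
      h.elim (fun h => h ⟨_, h', rfl⟩) fun h => h ⟨_, h', rfl⟩
    exact image_eq_zero_of_notMem_tsupport (f := F.uncurry) this
  constructor
  · rw [← continuousOn_univ]
    refine continuousOn_integral_of_compact_support (f := fun x y => F y x)
      (IsCompact.image hs continuous_fst) ?_ fun x y _ hy => hzero y x (Or.inl hy)
    exact (hF.comp continuous_swap).continuousOn
  · refine HasCompactSupport.intro (IsCompact.image hs continuous_snd) fun x hx => ?_
    simp [hzero _ x (Or.inr hx)]

/-- Take bumps `f` near `D` and `g = 1` on `N D⁻¹`, and integrate `g(y) f(y⁻¹x)` in both orders. One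
order gives `(∫ g)(∫ f) ≤ ε ∫ g`. In the other, the integrand is `1` for `x ∈ N`, `y ∈ x D⁻¹`, so
the value is at least `μ(N) μ(D⁻¹)`. -/
lemma measure_inv_eq_zero_of_isCompact {D : Set G} (hD : IsCompact D) (h0 : μ D = 0) :
    μ D⁻¹ = 0 := by
  obtain ⟨N, hN, hN1⟩ := exists_compact_mem_nhds (1 : G)
  have hND : IsCompact (N * D⁻¹) := hN.mul hD.inv
  obtain ⟨g, hg1, hg2, -, hg4⟩ := exists_continuousMap_one_of_isCompact_subset_isOpen hND
    isOpen_univ (Set.subset_univ _)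
  have hNpos : 0 < μ.real N := ENNReal.toReal_pos (Measure.measure_pos_of_mem_nhds μ hN1).ne'
    hN.measure_lt_top.ne
  have key : ∀ ε > 0, μ.real N * μ.real D⁻¹ ≤ (∫ y, g y ∂μ) * ε := by
    intro ε hε
    obtain ⟨U, hDU, hU, hμU⟩ := D.exists_isOpen_lt_of_lt (ENNReal.ofReal ε)
      (by rw [h0]; exact ENNReal.ofReal_pos.2 hε)
    obtain ⟨f, hf1, hf2, hf3, hf4⟩ := exists_continuousMap_one_of_isCompact_subset_isOpen hD hU hDU
    have hfint : ∫ x, f x ∂μ ≤ ε := by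
      have h1 : ∫ x, f x ∂μ ≤ ∫ x, U.indicator (fun _ => (1 : ℝ)) x ∂μ := by
        refine integral_mono (f.continuous.integrable_of_hasCompactSupport hf2)
          ((integrable_indicator_iff hU.measurableSet).2
            (integrableOn_const (hμU.trans ENNReal.ofReal_lt_top).ne)) fun x => ?_
        by_cases hx : x ∈ U
        · simpa [hx] using (hf4 x).2
        · simp [hx, image_eq_zero_of_notMem_tsupport fun h => hx (hf3 h)]
      rw [integral_indicator hU.measurableSet, setIntegral_const, smul_eq_mul, mul_one] at h1
      exact h1.trans (ENNReal.toReal_le_of_le_ofReal hε.le hμU.le)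
    let F : G → G → ℝ := fun y x => g y * f (y⁻¹ * x)
    have hF : Continuous F.uncurry :=
      (g.continuous.comp continuous_fst).mul
        (f.continuous.comp (continuous_fst.inv.mul continuous_snd))
    have hFs : HasCompactSupport F.uncurry := hasCompactSupport_uncurry_inv_mul hg2 hf2
      fun y x h => ⟨subset_tsupport _ (left_ne_zero_of_mul h),
        subset_tsupport _ (right_ne_zero_of_mul h)⟩
    have hswap := integral_integral_swap_of_hasCompactSupport hF hFs (μ := μ) (ν := μ)
    have hleft : ∫ y, ∫ x, F y x ∂μ ∂μ = (∫ y, g y ∂μ) * ∫ x, f x ∂μ := by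
      simp only [F, integral_const_mul, integral_mul_left_eq_self (fun x => f x), integral_mul_const]
    obtain ⟨hc, hcs⟩ := continuous_hasCompactSupport_integral μ hF hFs
    have hFnn : ∀ y x, 0 ≤ F y x := fun y x => mul_nonneg (hg4 y).1 (hf4 _).1
    have hright : μ.real N * μ.real D⁻¹ ≤ ∫ x, ∫ y, F y x ∂μ ∂μ := by
      have h1 : ∫ x, N.indicator (fun _ => μ.real D⁻¹) x ∂μ ≤ ∫ x, ∫ y, F y x ∂μ ∂μ := by
        refine integral_mono ((integrable_indicator_iff hN.measurableSet).2
            (integrableOn_const hN.measure_lt_top.ne)) (hc.integrable_of_hasCompactSupport hcs)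
              fun x => ?_
        by_cases hx : x ∈ N
        · have hcont : Continuous fun y => F y x := hF.comp (continuous_id.prodMk continuous_const)
          have hsupp : HasCompactSupport fun y => F y x :=
            HasCompactSupport.mono (f := g) hg2 fun y hy => left_ne_zero_of_mul hy
          have hS : MeasurableSet ((fun y => x⁻¹ * y) ⁻¹' D⁻¹) :=
            (hD.inv.measurableSet).preimage (measurable_const_mul _)
          have hμS : μ ((fun y => x⁻¹ * y) ⁻¹' D⁻¹) = μ D⁻¹ := measure_preimage_mul μ x⁻¹ D⁻¹
          have h2 : ∫ y, ((fun y => x⁻¹ * y) ⁻¹' D⁻¹).indicator (fun _ => (1 : ℝ)) y ∂μ ≤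
              ∫ y, F y x ∂μ := by
            refine integral_mono ((integrable_indicator_iff hS).2
              (integrableOn_const (by rw [hμS]; exact hD.inv.measure_lt_top.ne)))
              (hcont.integrable_of_hasCompactSupport hsupp) fun y => ?_
            by_cases hy : x⁻¹ * y ∈ D⁻¹
            · have e1 : g y = 1 := hg1 ⟨x, hx, x⁻¹ * y, hy, mul_inv_cancel_left x y⟩
              have e2 : f (y⁻¹ * x) = 1 := hf1 (by simpa using hy)
              rw [Set.indicator_of_mem (show y ∈ (fun y => x⁻¹ * y) ⁻¹' D⁻¹ from hy)]
              simp [F, e1, e2]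
            · rw [Set.indicator_of_notMem (show y ∉ (fun y => x⁻¹ * y) ⁻¹' D⁻¹ from hy)]
              exact hFnn y x
          rw [integral_indicator hS, setIntegral_const, smul_eq_mul, mul_one, measureReal_def,
            hμS] at h2
          simpa [hx, measureReal_def] using h2
        · simpa [hx] using integral_nonneg fun y => hFnn y x
      rwa [integral_indicator hN.measurableSet, setIntegral_const, smul_eq_mul] at h1
    rw [← hswap, hleft] at hright
    exact hright.trans (mul_le_mul_of_nonneg_left hfint (integral_nonneg fun y => (hg4 y).1))
  have hle : μ.real N * μ.real D⁻¹ ≤ 0 := by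
    refine ge_of_tendsto (f := fun ε : ℝ => (∫ y, g y ∂μ) * ε) (x := nhdsWithin 0 (Set.Ioi 0)) ?_
      (Filter.eventually_of_mem self_mem_nhdsWithin fun ε hε => key ε hε)
    have : Filter.Tendsto (fun ε : ℝ => (∫ y, g y ∂μ) * ε) (nhds 0) (nhds ((∫ y, g y ∂μ) * 0)) :=
      (continuous_const.mul continuous_id).tendsto 0
    rw [mul_zero] at this
    exact this.mono_left nhdsWithin_le_nhds
  have h1 : μ.real D⁻¹ = 0 := le_antisymm (by
    by_contra h
    exact absurd (mul_pos hNpos (not_le.1 h)) (not_lt.2 hle)) measureReal_nonneg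
  exact (measureReal_eq_zero_iff hD.inv.measure_lt_top.ne).1 h1

/-- Inside `K` the exceptional set has finite measure and is exhausted by compact sets. The image of
each under `y ↦ y⁻¹x` is compact and null, so the previous lemma applies. -/
lemma ae_mem_compact_inv_mul {p : G → Prop} (h : ∀ᵐ x ∂μ, p x) (x : G) {K : Set G}
    (hK : IsCompact K) : ∀ᵐ y ∂μ, y ∈ K → p (y⁻¹ * x) := by
  let M := toMeasurable μ {x | ¬ p x}
  have hM0 : μ M = 0 := by rw [measure_toMeasurable]; exact h
  let S : Set G := K ∩ (fun y => y⁻¹ * x) ⁻¹' M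
  have hmeas : Measurable fun y : G => y⁻¹ * x := (continuous_inv.mul continuous_const).measurable
  have hS : MeasurableSet S :=
    hK.measurableSet.inter ((measurableSet_toMeasurable _ _).preimage hmeas)
  have hSfin : μ S ≠ ⊤ := ((measure_mono Set.inter_subset_left).trans_lt hK.measure_lt_top).ne
  have hS0 : μ S = 0 := by
    rw [hS.measure_eq_iSup_isCompact_of_ne_top hSfin]
    simp only [ENNReal.iSup_eq_zero]
    intro C hCS hC
    have hD : IsCompact ((fun y => y⁻¹ * x) '' C) :=
      hC.image (continuous_inv.mul continuous_const)
    have hD0 : μ ((fun y => y⁻¹ * x) '' C) = 0 := measure_mono_null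
      (by rintro _ ⟨y, hy, rfl⟩; exact (hCS hy).2) hM0
    have h1 := measure_inv_eq_zero_of_isCompact μ hD hD0
    rw [← measure_preimage_mul μ x⁻¹] at h1
    refine measure_mono_null (fun y hy => ?_) h1
    exact ⟨y, hy, by simp⟩
  refine measure_mono_null (fun y hy => ?_) hS0
  simp only [Set.mem_compl_iff, Set.mem_ofPred_eq, not_forall] at hy
  obtain ⟨h1, h2⟩ := hy
  exact ⟨h1, subset_toMeasurable μ _ h2⟩

end InverseNull

/-! ### The pointwise twisted convolution -/

section Convolution

namespace TwistedAction

variable {G : Type u} {A : Type v} [Group G] [TopologicalSpace G] [IsTopologicalGroup G]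
  [LocallyCompactSpace G] [T2Space G] [MeasurableSpace G] [BorelSpace G] [NonUnitalCStarAlgebra A]
  (T : TwistedAction G A) {μ : Measure G} [μ.IsHaarMeasure] [μ.Regular]

lemma continuous_convIntegrand {Φ Ψ : G → A} (hΦ : Continuous Φ) (hΨ : Continuous Ψ) :
    Continuous fun p : G × G => T.convIntegrand Φ Ψ p.2 p.1 := by
  simp_rw [convIntegrand_eq]
  exact (hΦ.comp continuous_fst).mul (T.continuous_cell continuous_fst continuous_snd
    (hΨ.comp (continuous_fst.inv.mul continuous_snd)))

lemma hasCompactSupport_convIntegrand {Φ Ψ : G → A} (hΦ : HasCompactSupport Φ)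
    (hΨ : HasCompactSupport Ψ) :
    HasCompactSupport (fun y x => T.convIntegrand Φ Ψ x y : G → G → A).uncurry :=
  hasCompactSupport_uncurry_inv_mul hΦ hΨ fun y x h => by
    rw [convIntegrand_eq] at h
    refine ⟨subset_tsupport _ (left_ne_zero_of_mul h), subset_tsupport _ fun h0 => ?_⟩
    rw [h0, map_zero, mul_zero] at h
    exact h rfl

lemma integrable_convIntegrand {Φ Ψ : G → A} (hΦ : Continuous Φ) (hΨ : Continuous Ψ)
    (hΦs : HasCompactSupport Φ) (x : G) : Integrable (T.convIntegrand Φ Ψ x) μ := by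
  refine Continuous.integrable_of_hasCompactSupport
    ((T.continuous_convIntegrand hΦ hΨ).comp (continuous_id.prodMk continuous_const)) ?_
  refine hΦs.mono fun y hy => ?_
  rw [Function.mem_support, convIntegrand_eq] at hy
  exact left_ne_zero_of_mul hy

lemma norm_convIntegrand_le (Φ Ψ : G → A) (x y : G) :
    ‖T.convIntegrand Φ Ψ x y‖ ≤ ‖Φ y‖ * ‖Ψ (y⁻¹ * x)‖ := by
  rw [convIntegrand_eq, ← T.norm_cell_apply y x (Ψ (y⁻¹ * x))]
  exact norm_mul_le _ _

/-- Both sides have the same integral over each set of finite measure, because the order of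
integration may be exchanged for a continuous integrand of compact support. -/
lemma conv_ae_eq_of_hasCompactSupport {Φ Ψ : G → A} (hΦ : Continuous Φ) (hΨ : Continuous Ψ)
    (hΦs : HasCompactSupport Φ) (hΨs : HasCompactSupport Ψ) (hΦi : Integrable Φ μ)
    (hΨi : Integrable Ψ μ) :
    Integrable (T.conv μ Φ Ψ) μ ∧ T.conv μ Φ Ψ =ᵐ[μ] T.convL1 μ (hΦi.toL1 Φ) (hΨi.toL1 Ψ) := by
  have hF := T.continuous_convIntegrand hΦ hΨ
  have hFs := T.hasCompactSupport_convIntegrand hΦs hΨs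
  obtain ⟨hc, hcs⟩ := continuous_hasCompactSupport_integral μ
    (F := fun y x => T.convIntegrand Φ Ψ x y) hF hFs
  have hint : Integrable (T.conv μ Φ Ψ) μ := hc.integrable_of_hasCompactSupport hcs
  refine ⟨hint, hint.ae_eq_of_forall_setIntegral_eq _ _ (L1.integrable_coeFn _) fun s hs hμs => ?_⟩
  change _ = setIntegralL1 μ s _
  rw [convL1_toL1, ← ContinuousLinearMap.integral_comp_comm _ (T.integrable_productFamily _ hΦi)]
  have h1 : ∀ y, setIntegralL1 μ s (T.coeffMul μ (Φ y) (T.translate μ y (hΨi.toL1 Ψ))) =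
      ∫ x in s, T.convIntegrand Φ Ψ x y ∂μ := by
    intro y
    refine integral_congr_ae (ae_restrict_of_ae ?_)
    filter_upwards [T.coeffMul_ae μ (Φ y) (T.translate μ y (hΨi.toL1 Ψ)),
      T.translate_ae μ y (hΨi.toL1 Ψ), ae_comp_inv_mul hΨi.coeFn_toL1 y] with x h1 h2 h3
    rw [h1, h2, h3, convIntegrand_eq]
  simp_rw [h1]
  exact (integral_integral_swap_of_hasCompactSupport (f := fun y x => T.convIntegrand Φ Ψ x y)
    hF hFs (μ := μ) (ν := μ.restrict s)).symm

lemma integral_norm_mul_norm {Φ Ψ : G → A} (hΦ : Continuous Φ) (hΨ : Continuous Ψ)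
    (hΦs : HasCompactSupport Φ) (hΨs : HasCompactSupport Ψ) :
    Integrable (fun x => ∫ y, ‖Φ y‖ * ‖Ψ (y⁻¹ * x)‖ ∂μ) μ ∧
      ∫ x, ∫ y, ‖Φ y‖ * ‖Ψ (y⁻¹ * x)‖ ∂μ ∂μ = (∫ y, ‖Φ y‖ ∂μ) * ∫ x, ‖Ψ x‖ ∂μ := by
  let F : G → G → ℝ := fun y x => ‖Φ y‖ * ‖Ψ (y⁻¹ * x)‖
  have hF : Continuous F.uncurry := (hΦ.comp continuous_fst).norm.mul
    (hΨ.comp (continuous_fst.inv.mul continuous_snd)).norm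
  have hFs : HasCompactSupport F.uncurry := hasCompactSupport_uncurry_inv_mul hΦs hΨs
    fun y x h => ⟨subset_tsupport _ (norm_ne_zero_iff.1 (left_ne_zero_of_mul h)),
      subset_tsupport _ (norm_ne_zero_iff.1 (right_ne_zero_of_mul h))⟩
  obtain ⟨hc, hcs⟩ := continuous_hasCompactSupport_integral μ hF hFs
  refine ⟨hc.integrable_of_hasCompactSupport hcs, ?_⟩
  rw [← integral_integral_swap_of_hasCompactSupport hF hFs (μ := μ) (ν := μ)]
  simp only [F, integral_const_mul, integral_mul_left_eq_self (fun x => ‖Ψ x‖), integral_mul_const]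

/-- The series for `Ψ` at `y⁻¹x` is controlled only for almost every `y` in a compact set. Countably
many supports of the `f n` suffice, since off their union every term vanishes. -/
lemma ae_hasSum_convIntegrand {Φ Ψ : G → A} {f g : ℕ → G → A}
    (hfs : ∀ n, HasCompactSupport (f n))
    (hf : ∀ᵐ x ∂μ, (Summable fun n => ‖f n x‖) ∧ HasSum (fun n => f n x) (Φ x))
    (hg : ∀ᵐ x ∂μ, (Summable fun n => ‖g n x‖) ∧ HasSum (fun n => g n x) (Ψ x)) (x : G) :
    ∀ᵐ y ∂μ, HasSum (fun p : ℕ × ℕ => T.convIntegrand (f p.1) (g p.2) x y)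
      (T.convIntegrand Φ Ψ x y) := by
  filter_upwards [hf, ae_all_iff.2 fun n => ae_mem_compact_inv_mul μ hg x (hfs n)] with y h1 h2
  simp_rw [convIntegrand_eq]
  by_cases hy : ∃ n, y ∈ tsupport (f n)
  · obtain ⟨n, hn⟩ := hy
    obtain ⟨h3, h4⟩ := h2 n hn
    have h5 : HasSum (fun m => T.cell y x (g m (y⁻¹ * x))) (T.cell y x (Ψ (y⁻¹ * x))) :=
      (T.cell y x).hasSum h4
    have h6 : Summable fun m => ‖T.cell y x (g m (y⁻¹ * x))‖ := by
      simpa only [norm_cell_apply] using h3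
    have h7 := hasSum_bilinear (ContinuousLinearMap.mul ℂ A) h1.2 h1.1 h5 h6
    simpa only [ContinuousLinearMap.mul_apply'] using h7
  · have h0 : ∀ n, f n y = 0 := fun n =>
      image_eq_zero_of_notMem_tsupport fun h => hy ⟨n, h⟩
    have hΦ0 : Φ y = 0 := by
      have := h1.2
      simp_rw [h0] at this
      exact this.unique hasSum_zero
    simp only [h0, hΦ0, zero_mul]
    exact hasSum_zero

lemma integral_norm_convIntegrand_le {Φ Ψ : G → A} (hΦ : Continuous Φ) (hΨ : Continuous Ψ)
    (hΦs : HasCompactSupport Φ) (x : G) :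
    ∫ y, ‖T.convIntegrand Φ Ψ x y‖ ∂μ ≤ ∫ y, ‖Φ y‖ * ‖Ψ (y⁻¹ * x)‖ ∂μ := by
  refine integral_mono (T.integrable_convIntegrand hΦ hΨ hΦs x).norm ?_
    fun y => T.norm_convIntegrand_le _ _ _ _
  refine Continuous.integrable_of_hasCompactSupport ?_ ?_
  · exact hΦ.norm.mul (hΨ.comp (continuous_inv.mul continuous_const)).norm
  · exact hΦs.mono fun y hy => norm_ne_zero_iff.1 (left_ne_zero_of_mul hy)

/-- The twisted convolution of integrable functions exists almost everywhere and represents the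
product in `L¹(G, A)`. -/
theorem conv_ae_eq {Φ Ψ : G → A} (hΦ : Integrable Φ μ) (hΨ : Integrable Ψ μ) :
    (∀ᵐ x ∂μ, Integrable (T.convIntegrand Φ Ψ x) μ) ∧
      T.conv μ Φ Ψ =ᵐ[μ] T.convL1 μ (hΦ.toL1 Φ) (hΨ.toL1 Ψ) := by
  obtain ⟨f, hfc, hfs, hfsum, hf⟩ := hΦ.exists_series
  obtain ⟨g, hgc, hgs, hgsum, hg⟩ := hΨ.exists_series
  have hfi : ∀ n, Integrable (f n) μ := fun n => (hfc n).integrable_of_hasCompactSupport (hfs n)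
  have hgi : ∀ n, Integrable (g n) μ := fun n => (hgc n).integrable_of_hasCompactSupport (hgs n)
  have hsumprod : Summable fun p : ℕ × ℕ => (∫ y, ‖f p.1 y‖ ∂μ) * ∫ x, ‖g p.2 x‖ ∂μ :=
    hfsum.mul_of_nonneg hgsum (fun _ => integral_nonneg fun _ => norm_nonneg _)
      fun _ => integral_nonneg fun _ => norm_nonneg _
  have hmaj := fun p : ℕ × ℕ => integral_norm_mul_norm (μ := μ) (hfc p.1) (hgc p.2) (hfs p.1)
    (hgs p.2)
  have hmaj_nn : ∀ (p : ℕ × ℕ) x, 0 ≤ ∫ y, ‖f p.1 y‖ * ‖g p.2 (y⁻¹ * x)‖ ∂μ := fun p x =>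
    integral_nonneg fun y => mul_nonneg (norm_nonneg _) (norm_nonneg _)
  -- The majorants have integrals `‖f m‖₁ ‖g n‖₁`, which are summable, so for almost every `x` the
  -- double series may be integrated term by term.
  have hmaj_ae : ∀ᵐ x ∂μ, Summable fun p : ℕ × ℕ => ∫ y, ‖f p.1 y‖ * ‖g p.2 (y⁻¹ * x)‖ ∂μ := by
    have h := ae_summable_norm_of_summable_integral_norm (fun p => (hmaj p).1) (by
      simp_rw [Real.norm_of_nonneg (hmaj_nn _ _), (hmaj _).2]
      exact hsumprod)
    simpa only [Real.norm_of_nonneg (hmaj_nn _ _)] using h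
  have hterm : ∀ (p : ℕ × ℕ) x, Integrable (T.convIntegrand (f p.1) (g p.2) x) μ := fun p x =>
    T.integrable_convIntegrand (hfc p.1) (hgc p.2) (hfs p.1) x
  have hterm_le := fun (p : ℕ × ℕ) x =>
    T.integral_norm_convIntegrand_le (μ := μ) (hfc p.1) (hgc p.2) (hfs p.1) x
  have hpt := fun x => T.ae_hasSum_convIntegrand hfs hf hg x
  have hae : ∀ᵐ x ∂μ, Integrable (T.convIntegrand Φ Ψ x) μ ∧
      HasSum (fun p : ℕ × ℕ => T.conv μ (f p.1) (g p.2) x) (T.conv μ Φ Ψ x) := by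
    filter_upwards [hmaj_ae] with x hx
    have hs : Summable fun p : ℕ × ℕ => ∫ y, ‖T.convIntegrand (f p.1) (g p.2) x y‖ ∂μ :=
      Summable.of_nonneg_of_le (fun p => integral_nonneg fun y => norm_nonneg _)
        (fun p => hterm_le p x) hx
    exact ⟨integrable_of_hasSum (fun p => hterm p x) hs (hpt x),
      hasSum_integral_of_hasSum (fun p => hterm p x) hs (hpt x)⟩
  refine ⟨hae.mono fun x hx => hx.1, ?_⟩
  have hconv := fun p : ℕ × ℕ => T.conv_ae_eq_of_hasCompactSupport (hfc p.1) (hgc p.2) (hfs p.1)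
    (hgs p.2) (hfi p.1) (hgi p.2)
  have hconv_sum : Summable fun p : ℕ × ℕ => ∫ x, ‖T.conv μ (f p.1) (g p.2) x‖ ∂μ := by
    refine Summable.of_nonneg_of_le (fun p => integral_nonneg fun y => norm_nonneg _)
      (fun p => ?_) hsumprod
    rw [← (hmaj p).2]
    exact integral_mono (hconv p).1.norm (hmaj p).1 fun x =>
      (norm_integral_le_integral_norm _).trans (hterm_le p x)
  have hL1 := hasSum_toL1 (fun p => (hconv p).1) hconv_sum (hae.mono fun x hx => hx.2)
  have hL1' : HasSum (fun p : ℕ × ℕ => (hconv p).1.toL1 (T.conv μ (f p.1) (g p.2)))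
      (T.convL1 μ (hΦ.toL1 Φ) (hΨ.toL1 Ψ)) := by
    have hfn : Summable fun n => ‖(hfi n).toL1 (f n)‖ := by
      simpa only [L1.norm_of_fun_eq_integral_norm] using hfsum
    have hgn : Summable fun n => ‖(hgi n).toL1 (g n)‖ := by
      simpa only [L1.norm_of_fun_eq_integral_norm] using hgsum
    have h := hasSum_bilinear (T.convL1 μ) (hasSum_toL1 hfi hfsum (hf.mono fun x hx => hx.2)) hfn
      (hasSum_toL1 hgi hgsum (hg.mono fun x hx => hx.2)) hgn
    have heq : (fun p : ℕ × ℕ => (hconv p).1.toL1 (T.conv μ (f p.1) (g p.2))) =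
        fun p => T.convL1 μ ((hfi p.1).toL1 (f p.1)) ((hgi p.2).toL1 (g p.2)) := by
      funext p
      ext1
      exact ((hconv p).1.coeFn_toL1).trans (hconv p).2
    rwa [heq]
  rw [← hL1.unique hL1']
  exact (Integrable.coeFn_toL1 _).symm

end TwistedAction

end Convolution

/-! ### Approximate units of C⋆-algebras -/

section ApproximateUnit

open Filter Topology

/-- Pointwise convergence of contractions to the identity is uniform on compact sets, by a
three-term estimate with `ε/3`. -/
lemma eventually_forall_norm_sub_lt {ι E : Type*} [NormedAddCommGroup E] [NormedSpace ℂ E]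
    {l : Filter ι} {S : ι → E →L[ℂ] E} (hS : ∀ᶠ i in l, ‖S i‖ ≤ 1)
    (h : ∀ c, Tendsto (fun i => S i c) l (𝓝 c)) {K : Set E} (hK : IsCompact K) {ε : ℝ}
    (hε : 0 < ε) : ∀ᶠ i in l, ∀ c ∈ K, ‖S i c - c‖ < ε := by
  refine hK.induction_on (p := fun K => ∀ᶠ i in l, ∀ c ∈ K, ‖S i c - c‖ < ε) ?_ ?_ ?_ ?_
  · exact Eventually.of_forall fun i c hc => hc.elim
  · exact fun s t hst ht => ht.mono fun i hi c hc => hi c (hst hc)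
  · intro s t hs ht
    filter_upwards [hs, ht] with i h1 h2 c hc
    exact hc.elim (h1 c) (h2 c)
  · intro c _
    refine ⟨Metric.ball c (ε / 3), mem_nhdsWithin_of_mem_nhds
      (Metric.ball_mem_nhds _ (by positivity)), ?_⟩
    filter_upwards [hS, Metric.tendsto_nhds.1 (h c) (ε / 3) (by positivity)] with i h1 h2 d hd
    rw [dist_eq_norm] at h2
    rw [Metric.mem_ball, dist_eq_norm] at hd
    have h3 : ‖S i (d - c)‖ ≤ ‖d - c‖ :=
      ((S i).le_of_opNorm_le h1 _).trans_eq (one_mul _)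
    have h4 : S i d - d = S i (d - c) + (S i c - c) - (d - c) := by rw [map_sub]; abel
    rw [h4]
    calc _ ≤ ‖S i (d - c)‖ + ‖S i c - c‖ + ‖d - c‖ :=
          (norm_sub_le _ _).trans (by gcongr; exact norm_add_le _ _)
      _ < ε := by linarith

lemma exists_approximateUnit (A : Type v) [NonUnitalCStarAlgebra A] :
    ∃ l : Filter A, l.NeBot ∧ (∀ᶠ a in l, ‖a‖ ≤ 1) ∧ (∀ c, Tendsto (fun a => a * c) l (𝓝 c)) ∧
      ∀ c, Tendsto (fun a => c * a) l (𝓝 c) := by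
  let _ := CStarAlgebra.spectralOrder A
  have := CStarAlgebra.spectralOrderedRing A
  have h := CStarAlgebra.increasingApproximateUnit A
  exact ⟨CStarAlgebra.approximateUnit A, inferInstance, h.eventually_norm,
    h.tendsto_mul_right, h.tendsto_mul_left⟩

end ApproximateUnit

/-! ### Integrals in closed subspaces and an `L¹` norm bound -/

section ClosedSpan

lemma integral_mem_of_isClosed {X E : Type*} [MeasurableSpace X] {μ : Measure X}
    [NormedAddCommGroup E] [NormedSpace ℂ E] [CompleteSpace E] {S : Submodule ℂ E}
    (hS : IsClosed (S : Set E)) {f : X → E} (hf : Integrable f μ) (hfS : ∀ x, f x ∈ S) :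
    ∫ x, f x ∂μ ∈ S := by
  have : IsClosed (S : Set E) := hS
  rw [← Submodule.Quotient.mk_eq_zero S]
  change S.mkQL _ = 0
  rw [← ContinuousLinearMap.integral_comp_comm _ hf]
  refine integral_eq_zero_of_ae (Filter.Eventually.of_forall fun x => ?_)
  exact (Submodule.Quotient.mk_eq_zero S).2 (hfS x)

end ClosedSpan

lemma norm_le_mul_measureReal {X E : Type*} [MeasurableSpace X] {μ : Measure X}
    [NormedAddCommGroup E] (f : Lp E 1 μ) {S : Set X} (hS : MeasurableSet S) (hμS : μ S ≠ ⊤) {δ : ℝ}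
    (hf : ∀ᵐ x ∂μ, ‖f x‖ ≤ S.indicator (fun _ => δ) x) : ‖f‖ ≤ δ * μ.real S := by
  rw [L1.norm_eq_integral_norm]
  refine (integral_mono_ae (L1.integrable_coeFn f).norm
    ((integrable_indicator_iff hS).2 (integrableOn_const hμS)) hf).trans_eq ?_
  rw [integral_indicator hS, setIntegral_const, smul_eq_mul, mul_comm]

namespace TwistedAction

variable {G : Type u} {A : Type v} [Group G] [TopologicalSpace G] [IsTopologicalGroup G]
  [LocallyCompactSpace G] [T2Space G] [MeasurableSpace G] [BorelSpace G] [NonUnitalCStarAlgebra A]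
  (T : TwistedAction G A) (μ : Measure G) [μ.IsHaarMeasure] [μ.Regular]

open Filter Topology DoubleCentralizer

/-! ### Unitary translates as isometric multipliers -/

section UnitaryTranslate

lemma norm_multiplierMul_unitary (v : unitary 𝓜(ℂ, A)) (f : Lp A 1 μ) :
    ‖T.multiplierMul μ v f‖ = ‖f‖ := by
  rw [L1.norm_eq_integral_norm, L1.norm_eq_integral_norm]
  refine integral_congr_ae ?_
  filter_upwards [T.multiplierMul_ae μ v f] with x hx
  rw [hx, norm_fst_unitary_apply]

/-- The isometry `f ↦ v L_y f` of `L¹(G, A)` for a unitary multiplier `v` and `y ∈ G`. -/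
noncomputable def unitaryTranslate (v : unitary 𝓜(ℂ, A)) (y : G) : Lp A 1 μ ≃ₗᵢ[ℂ] Lp A 1 μ :=
  LinearIsometryEquiv.ofSurjective
    { toLinearMap := (T.multiplierMul μ v).toLinearMap ∘ₗ (T.translate μ y).toLinearMap
      norm_map' := fun f =>
        (T.norm_multiplierMul_unitary μ v _).trans ((T.translate μ y).norm_map f) }
    fun h => by
      -- Since `v L_y L_{y⁻¹} = v ω(y, y⁻¹)`, the preimage is obtained by applying the adjoint of
      -- this unitary first.
      refine ⟨T.translate μ y⁻¹ (T.multiplierMul μ (star (v * T.ω y y⁻¹) : unitary 𝓜(ℂ, A)) h), ?_⟩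
      change T.multiplierMul μ v (T.translate μ y (T.translate μ y⁻¹ _)) = h
      rw [translate_translate, mul_inv_cancel, translate_one, multiplierMul_multiplierMul,
        multiplierMul_multiplierMul, ← Submonoid.coe_mul, ← Submonoid.coe_mul,
        Unitary.mul_star_self, Submonoid.coe_one, multiplierMul_one]

lemma unitaryTranslate_apply (v : unitary 𝓜(ℂ, A)) (y : G) (f : Lp A 1 μ) :
    T.unitaryTranslate μ v y f = T.multiplierMul μ v (T.translate μ y f) := rfl

lemma unitaryTranslate_convL1 (v : unitary 𝓜(ℂ, A)) (y : G) (f g : Lp A 1 μ) :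
    T.unitaryTranslate μ v y (T.convL1 μ f g) = T.convL1 μ (T.unitaryTranslate μ v y f) g := by
  simp only [unitaryTranslate_apply, translate_convL1, multiplierMul_convL1]

/-- Even when `A` has no unit, its elements are finite combinations of unitaries in the unital
C⋆-algebra of multipliers. -/
lemma coeffMul_translate_mem_span (a : A) (y : G) (g : Lp A 1 μ) :
    T.coeffMul μ a (T.translate μ y g) ∈
      Submodule.span ℂ (Set.range fun p : unitary 𝓜(ℂ, A) × G => T.unitaryTranslate μ p.1 p.2 g) := by
  let L : 𝓜(ℂ, A) →ₗ[ℂ] Lp A 1 μ :=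
    { toFun := fun u => T.multiplierMul μ u (T.translate μ y g)
      map_add' := fun u w => by
        ext1
        filter_upwards [T.multiplierMul_ae μ (u + w) (T.translate μ y g),
          T.multiplierMul_ae μ u (T.translate μ y g), T.multiplierMul_ae μ w (T.translate μ y g),
          Lp.coeFn_add (T.multiplierMul μ u (T.translate μ y g))
            (T.multiplierMul μ w (T.translate μ y g))] with x h1 h2 h3 h4
        rw [h1, h4, Pi.add_apply, h2, h3]
        simp
      map_smul' := fun c u => by
        ext1
        filter_upwards [T.multiplierMul_ae μ (c • u) (T.translate μ y g),
          T.multiplierMul_ae μ u (T.translate μ y g),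
          Lp.coeFn_smul c (T.multiplierMul μ u (T.translate μ y g))] with x h1 h2 h4
        rw [h1, RingHom.id_apply, h4, Pi.smul_apply, h2]
        simp }
  have h : (a : 𝓜(ℂ, A)) ∈ Submodule.span ℂ (unitary 𝓜(ℂ, A) : Set 𝓜(ℂ, A)) := by
    rw [CStarAlgebra.span_unitary]
    trivial
  have h2 := Submodule.mem_map_of_mem (f := L) h
  rw [Submodule.map_span] at h2
  rw [coeffMul_eq_multiplierMul]
  refine Submodule.span_mono ?_ h2
  rintro _ ⟨v, hv, rfl⟩
  exact ⟨(⟨v, hv⟩, y), rfl⟩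

lemma convL1_mem_closure_span (f g : Lp A 1 μ) : T.convL1 μ f g ∈
    (Submodule.span ℂ (Set.range fun p : unitary 𝓜(ℂ, A) × G =>
      T.unitaryTranslate μ p.1 p.2 g)).topologicalClosure := by
  rw [convL1_apply]
  exact integral_mem_of_isClosed (Submodule.isClosed_topologicalClosure _)
    (T.integrable_productFamily g (L1.integrable_coeFn f)) fun y =>
      Submodule.le_topologicalClosure _ (T.coeffMul_translate_mem_span μ _ y g)

end UnitaryTranslate

/-! ### Left approximate units in `L¹` -/

section ApproximateUnit

/-- The class of the function `a / μ(V)` on `V`, zero outside `V`. -/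
noncomputable def averagingElement (_T : TwistedAction G A) {V : Set G} (hV : IsCompact V) (a : A) :
    Lp A 1 μ :=
  Integrable.toL1 (V.indicator fun _ => ((μ.real V)⁻¹ : ℝ) • a)
    ((integrable_indicator_iff hV.measurableSet).2 (integrableOn_const hV.measure_lt_top.ne))

lemma norm_averagingElement_le {V : Set G} (hV : IsCompact V) {a : A} (ha : ‖a‖ ≤ 1) :
    ‖T.averagingElement μ hV a‖ ≤ 1 := by
  rw [averagingElement, L1.norm_of_fun_eq_integral_norm]
  simp_rw [norm_indicator_eq_indicator_norm]
  rw [integral_indicator hV.measurableSet, setIntegral_const, norm_smul, norm_inv,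
    Real.norm_of_nonneg measureReal_nonneg, smul_eq_mul, ← mul_assoc]
  exact mul_le_one₀ (mul_inv_le_one) (norm_nonneg _) ha

lemma convL1_averagingElement_left {V : Set G} (hV : IsCompact V) (a : A) (f : Lp A 1 μ) :
    T.convL1 μ (T.averagingElement μ hV a) f =
      ⨍ y in V, T.coeffMul μ a (T.translate μ y f) ∂μ := by
  rw [averagingElement, convL1_toL1, setAverage_eq, ← integral_smul, ← integral_indicator
    hV.measurableSet]
  refine integral_congr_ae (Eventually.of_forall fun y => ?_)
  by_cases hy : y ∈ V
  · simp only [Set.indicator_of_mem hy]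
    rw [← Complex.coe_smul, map_smul]
    rfl
  · simp [Set.indicator_of_notMem hy]

lemma tendsto_coeffMul {l : Filter A} (hl : ∀ᶠ a in l, ‖a‖ ≤ 1)
    (h : ∀ c, Tendsto (fun a => a * c) l (𝓝 c)) (f : Lp A 1 μ) :
    Tendsto (fun a => T.coeffMul μ a f) l (𝓝 f) := by
  rw [Metric.tendsto_nhds]
  intro ε hε
  obtain ⟨g, hg, hgs, hgi, hfg⟩ := exists_norm_sub_lt μ f (show 0 < ε / 3 by positivity)
  let S := tsupport g
  have hSfin : μ S ≠ ⊤ := (IsCompact.measure_lt_top hgs).ne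
  have hδ : 0 < ε / 3 / (μ.real S + 1) := by have := measureReal_nonneg (μ := μ) (s := S); positivity
  have hev := eventually_forall_norm_sub_lt (S := fun a => ContinuousLinearMap.mul ℂ A a)
    (hl.mono fun a ha => (ContinuousLinearMap.opNorm_mul_apply_le ℂ A a).trans ha) h
    (hgs.isCompact_range hg) hδ
  filter_upwards [hl, hev] with a ha h1
  have h2 : ‖T.coeffMul μ a (hgi.toL1 g) - hgi.toL1 g‖ ≤ ε / 3 / (μ.real S + 1) * μ.real S := by
    refine norm_le_mul_measureReal _ (isClosed_tsupport g).measurableSet hSfin ?_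
    filter_upwards [Lp.coeFn_sub (T.coeffMul μ a (hgi.toL1 g)) (hgi.toL1 g),
      T.coeffMul_ae μ a (hgi.toL1 g), hgi.coeFn_toL1] with x h3 h4 h5
    rw [h3, Pi.sub_apply, h4, h5]
    by_cases hx : x ∈ S
    · rw [Set.indicator_of_mem hx]
      exact (h1 _ ⟨x, rfl⟩).le
    · rw [Set.indicator_of_notMem hx, image_eq_zero_of_notMem_tsupport hx]
      simp
  have h3 : ε / 3 / (μ.real S + 1) * μ.real S ≤ ε / 3 := by
    rw [div_mul_eq_mul_div, div_le_iff₀ (by have := measureReal_nonneg (μ := μ) (s := S); positivity)]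
    nlinarith
  have h4 : ‖T.coeffMul μ a (f - hgi.toL1 g)‖ ≤ ‖f - hgi.toL1 g‖ :=
    (T.norm_coeffMul_le μ a _).trans (mul_le_of_le_one_left (norm_nonneg _) ha)
  rw [dist_eq_norm]
  have h5 : T.coeffMul μ a f - f = T.coeffMul μ a (f - hgi.toL1 g) +
      (T.coeffMul μ a (hgi.toL1 g) - hgi.toL1 g) - (f - hgi.toL1 g) := by rw [map_sub]; abel
  rw [h5]
  calc _ ≤ ‖T.coeffMul μ a (f - hgi.toL1 g)‖ + ‖T.coeffMul μ a (hgi.toL1 g) - hgi.toL1 g‖ +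
        ‖f - hgi.toL1 g‖ := (norm_sub_le _ _).trans (by gcongr; exact norm_add_le _ _)
    _ < ε := by linarith

/-- With `e = a / μ(V)` on a small neighbourhood `V` of `1`, the product `e * f` is the average over
`V` of `a L_y f`. Every such value is within `ε/2` of `f`, and closed balls are convex. -/
lemma exists_convL1_left_norm_sub_lt (F : Finset (Lp A 1 μ)) {ε : ℝ} (hε : 0 < ε) :
    ∃ e : Lp A 1 μ, ∀ f ∈ F, ‖T.convL1 μ e f - f‖ < ε := by
  obtain ⟨l, _, hl1, hl2, -⟩ := exists_approximateUnit A
  have hev : ∀ᶠ a in l, ‖a‖ ≤ 1 ∧ ∀ f ∈ F, ‖T.coeffMul μ a f - f‖ < ε / 4 := by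
    refine hl1.and ((Finset.eventually_all F).2 fun f _ => ?_)
    simpa only [dist_eq_norm] using
      Metric.tendsto_nhds.1 (T.tendsto_coeffMul μ hl1 hl2 f) (ε / 4) (by positivity)
  obtain ⟨a, ha, haF⟩ := hev.exists
  have hV : ∀ᶠ y in 𝓝 (1 : G), ∀ f ∈ F, ‖T.translate μ y f - f‖ < ε / 4 := by
    refine (Finset.eventually_all F).2 fun f _ => ?_
    have h := (T.continuous_translate μ f).tendsto 1
    rw [translate_one] at h
    simpa only [dist_eq_norm] using Metric.tendsto_nhds.1 h (ε / 4) (by positivity)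
  obtain ⟨V, hV1, hVsub, hVc⟩ := local_compact_nhds hV
  have hV0 : μ V ≠ 0 := (Measure.measure_pos_of_mem_nhds μ hV1).ne'
  refine ⟨T.averagingElement μ hVc a, fun f hf => ?_⟩
  rw [convL1_averagingElement_left, ← mem_ball_iff_norm]
  refine Metric.closedBall_subset_ball (half_lt_self hε) ?_
  refine (convex_closedBall f (ε / 2)).set_average_mem Metric.isClosed_closedBall hV0
    hVc.measure_lt_top.ne (ae_restrict_of_forall_mem hVc.measurableSet fun y hy => ?_) ?_
  · rw [mem_closedBall_iff_norm]
    have h1 : T.coeffMul μ a (T.translate μ y f) - f = T.coeffMul μ a (T.translate μ y f - f) +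
      (T.coeffMul μ a f - f) := by rw [map_sub]; abel
    rw [h1]
    have h2 : ‖T.coeffMul μ a (T.translate μ y f - f)‖ ≤ ‖T.translate μ y f - f‖ :=
      (T.norm_coeffMul_le μ a _).trans (mul_le_of_le_one_left (norm_nonneg _) ha)
    have h3 : ‖T.translate μ y f - f‖ < ε / 4 := hVsub hy f hf
    refine (norm_add_le _ _).trans ?_
    linarith [haF f hf]
  · exact ((T.coeffMul μ a).continuous.comp
      (T.continuous_translate μ f)).continuousOn.integrableOn_compact hVc

end ApproximateUnit

end TwistedAction

/-! ### Right approximate units and the Banach algebra structure -/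

namespace TwistedAction

open Filter Topology DoubleCentralizer

section

variable {G : Type u} {A : Type v} [Group G] [TopologicalSpace G] [NonUnitalCStarAlgebra A]
  (T : TwistedAction G A)

lemma norm_α_apply (x : G) (a : A) : ‖T.α x a‖ = ‖a‖ :=
  (StarAlgEquiv.isometry (T.α x)).norm_map_of_map_zero (map_zero _) a

lemma continuous_α_symm_apply {f : G → A} (hf : Continuous f) :
    Continuous fun x => (T.α x).symm (f x) := by
  rw [continuous_iff_continuousAt]
  intro x₀
  set c := (T.α x₀).symm (f x₀) with hc
  have h : Tendsto (fun x => ‖f x - T.α x c‖) (𝓝 x₀) (𝓝 0) := by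
    have h1 := ((hf.sub (T.continuous_α c)).norm).tendsto x₀
    simpa [hc] using h1
  rw [ContinuousAt, tendsto_iff_norm_sub_tendsto_zero]
  refine h.congr fun x => ?_
  rw [← T.norm_α_apply x ((T.α x).symm (f x) - _), map_sub, StarAlgEquiv.apply_symm_apply]

/-- On the diagonal the cocycle is trivial, so applying `α_x⁻¹` turns an approximate unit moving
with `x` into the fixed element `a`. -/
lemma norm_mul_cell_self_sub (x : G) (b a : A) :
    ‖b * T.cell x x a - b‖ = ‖(T.α x).symm b * a - (T.α x).symm b‖ := by
  rw [← T.norm_α_apply x ((T.α x).symm b * a - _), map_sub, map_mul, StarAlgEquiv.apply_symm_apply, cell_apply,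
    inv_mul_cancel, T.ω_one_right]
  rfl

end

variable {G : Type u} {A : Type v} [Group G] [TopologicalSpace G] [IsTopologicalGroup G]
  [LocallyCompactSpace G] [T2Space G] [MeasurableSpace G] [BorelSpace G] [NonUnitalCStarAlgebra A]
  (T : TwistedAction G A) (μ : Measure G) [μ.IsHaarMeasure] [μ.Regular]

lemma conv_indicator_eq_average {V : Set G} (hV : IsCompact V) (hVs : V⁻¹ = V) (a : A) {Ψ : G → A}
    (x : G) : T.conv μ Ψ (V.indicator fun _ => ((μ.real V)⁻¹ : ℝ) • a) x =
      ⨍ y in x • V, Ψ y * T.cell y x a ∂μ := by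
  have hμ : μ.real (x • V) = μ.real V := by rw [measureReal_def, measure_smul, measureReal_def]
  rw [conv, setAverage_eq, hμ, ← integral_smul, ← integral_indicator (hV.smul x).measurableSet]
  refine integral_congr_ae (Eventually.of_forall fun y => ?_)
  have hiff : y⁻¹ * x ∈ V ↔ y ∈ x • V := by
    rw [Set.mem_smul_set_iff_inv_smul_mem, smul_eq_mul]
    nth_rewrite 2 [← hVs]
    rw [Set.mem_inv, mul_inv_rev, inv_inv]
  simp only [convIntegrand_eq]
  by_cases hy : y ∈ x • V
  · rw [Set.indicator_of_mem hy, Set.indicator_of_mem (hiff.2 hy)]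
    simp only [← Complex.coe_smul]
    rw [map_smul, mul_smul_comm]
  · rw [Set.indicator_of_notMem hy, Set.indicator_of_notMem (fun h => hy (hiff.1 h)), map_zero,
      mul_zero]

lemma exists_compact_symmetric_nhds_one {W : Set G} (hW : W ∈ 𝓝 (1 : G)) :
    ∃ V ∈ 𝓝 (1 : G), IsCompact V ∧ V⁻¹ = V ∧ V ⊆ W := by
  obtain ⟨V, hV1, hVW, hVc⟩ := local_compact_nhds hW
  refine ⟨V ∩ V⁻¹, inter_mem hV1 (inv_mem_nhds_one G hV1),
    hVc.inter_right hVc.inv.isClosed, ?_, Set.inter_subset_left.trans hVW⟩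
  rw [Set.inter_inv, inv_inv, Set.inter_comm]

/-- On the diagonal, `a` must be an approximate unit for the compact set of all `α_x⁻¹(Ψ x)`, `x ∈
S`. The tube lemma then extends the estimate to a uniform neighbourhood. -/
lemma exists_uniform_approximation {Ψ : G → A} (hΨ : Continuous Ψ) {S : Set G} (hS : IsCompact S)
    {δ : ℝ} (hδ : 0 < δ) : ∃ a : A, ‖a‖ ≤ 1 ∧ ∃ W ∈ 𝓝 (1 : G), ∀ x ∈ S, ∀ v ∈ W,
      ‖Ψ (x * v) * T.cell (x * v) x a - Ψ x‖ < δ := by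
  obtain ⟨l, _, hl1, -, hl2⟩ := exists_approximateUnit A
  have hev := eventually_forall_norm_sub_lt (S := fun a => (ContinuousLinearMap.mul ℂ A).flip a)
    (hl1.mono fun a ha => ContinuousLinearMap.opNorm_le_bound _ zero_le_one fun b => by
      rw [one_mul, ContinuousLinearMap.flip_apply, ContinuousLinearMap.mul_apply']
      exact (norm_mul_le _ _).trans (mul_le_of_le_one_right (norm_nonneg _) ha)) hl2
    (hS.image (T.continuous_α_symm_apply hΨ)) hδ
  obtain ⟨a, ha, h⟩ := (hl1.and hev).exists
  refine ⟨a, ha, ?_⟩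
  have hcont : Continuous fun p : G × G => ‖Ψ (p.1 * p.2) * T.cell (p.1 * p.2) p.1 a - Ψ p.1‖ :=
    (((hΨ.comp continuous_mul).mul (T.continuous_cell continuous_mul continuous_fst
      continuous_const)).sub (hΨ.comp continuous_fst)).norm
  have hopen := isOpen_Iio.preimage hcont (t := Set.Iio δ)
  obtain ⟨U, W, -, hW, hSU, h1W, hUW⟩ := generalized_tube_lemma hS (isCompact_singleton (x := (1 : G)))
    hopen (by
      rintro ⟨x, v⟩ ⟨hx, rfl⟩
      change ‖Ψ (x * 1) * T.cell (x * 1) x a - Ψ x‖ < δ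
      rw [mul_one, norm_mul_cell_self_sub]
      exact h _ ⟨x, hx, rfl⟩)
  exact ⟨W, hW.mem_nhds (h1W rfl), fun x hx v hv => hUW (Set.mk_mem_prod (hSU hx) hv)⟩

/-- The value of `Ψ * e` at `x` is an average over `xV`, uniformly close to `Ψ x` on a fixed compact
set and zero outside it. The bound `‖e‖ ≤ 1` is what lets density carry this over to all of `L¹`. -/
lemma exists_convL1_right_norm_sub_lt_of_hasCompactSupport {Ψ : G → A} (hΨ : Continuous Ψ)
    (hΨs : HasCompactSupport Ψ) (hΨi : Integrable Ψ μ) {ε : ℝ} (hε : 0 < ε) :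
    ∃ e : Lp A 1 μ, ‖e‖ ≤ 1 ∧ ‖T.convL1 μ (hΨi.toL1 Ψ) e - hΨi.toL1 Ψ‖ < ε := by
  obtain ⟨V₀, hV₀c, hV₀⟩ := exists_compact_mem_nhds (1 : G)
  have hS : IsCompact (tsupport Ψ * V₀) := IsCompact.mul hΨs hV₀c
  have hpos : 0 < μ.real (tsupport Ψ * V₀) + 1 := by
    have := measureReal_nonneg (μ := μ) (s := tsupport Ψ * V₀)
    positivity
  obtain ⟨a, ha, W, hW, hWS⟩ := T.exists_uniform_approximation hΨ hS (div_pos hε hpos)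
  obtain ⟨V, hV1, hVc, hVs, hVW⟩ := exists_compact_symmetric_nhds_one (inter_mem hW hV₀)
  have hV0 : μ V ≠ 0 := (Measure.measure_pos_of_mem_nhds μ hV1).ne'
  refine ⟨T.averagingElement μ hVc a, T.norm_averagingElement_le μ hVc ha, ?_⟩
  have hi : Integrable (V.indicator fun _ => ((μ.real V)⁻¹ : ℝ) • a) μ :=
    (integrable_indicator_iff hVc.measurableSet).2 (integrableOn_const hVc.measure_lt_top.ne)
  -- The added `1` gives `c * μ.real S < ε` even when the compact set `S = tsupport Ψ * V₀` is null.
  set c := ε / (μ.real (tsupport Ψ * V₀) + 1) with hc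
  refine lt_of_le_of_lt (norm_le_mul_measureReal _ hS.measurableSet hS.measure_lt_top.ne
    (δ := c) ?_) ?_
  · filter_upwards [Lp.coeFn_sub (T.convL1 μ (hΨi.toL1 Ψ) (T.averagingElement μ hVc a))
      (hΨi.toL1 Ψ), hΨi.coeFn_toL1, (T.conv_ae_eq hΨi hi).2] with x h1 h2 h3
    have h3' := h3.symm
    rw [conv_indicator_eq_average T μ hVc hVs] at h3'
    rw [h1, Pi.sub_apply, h2, averagingElement, h3', ← mem_closedBall_iff_norm]
    have hμ : μ (x • V) = μ V := measure_smul μ x V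
    refine (convex_closedBall _ _).set_average_mem Metric.isClosed_closedBall (by rwa [hμ])
      (by rw [hμ]; exact hVc.measure_lt_top.ne)
      (ae_restrict_of_forall_mem (hVc.smul x).measurableSet ?_) ?_
    · rintro _ ⟨v, hv, rfl⟩
      simp only [smul_eq_mul]
      rw [mem_closedBall_iff_norm]
      by_cases hx : x ∈ tsupport Ψ * V₀
      · rw [Set.indicator_of_mem hx]
        exact (hWS x hx v (hVW hv).1).le
      · have hx1 : Ψ x = 0 := by
          by_contra h
          exact hx ⟨x, subset_tsupport _ h, 1, mem_of_mem_nhds hV₀, mul_one x⟩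
        -- Symmetry of `V` puts `v⁻¹` in `V₀`, so `x v` in the support would force `x` into
        -- `tsupport Ψ * V₀`.
        have hx2 : Ψ (x * v) = 0 := by
          by_contra h
          refine hx ⟨x * v, subset_tsupport _ h, v⁻¹, (hVW ?_).2, mul_inv_cancel_right x v⟩
          rwa [← Set.mem_inv, hVs]
        rw [Set.indicator_of_notMem hx, hx1, hx2]
        simp
    · exact (hΨ.mul (T.continuous_cell continuous_id continuous_const
        continuous_const)).continuousOn.integrableOn_compact (hVc.smul x)
  · rw [hc, div_mul_eq_mul_div, div_lt_iff₀ hpos]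
    nlinarith

lemma exists_convL1_right_norm_sub_lt (f : Lp A 1 μ) {ε : ℝ} (hε : 0 < ε) :
    ∃ e : Lp A 1 μ, ‖T.convL1 μ f e - f‖ < ε := by
  obtain ⟨g, hg, hgs, hgi, hfg⟩ := exists_norm_sub_lt μ f (show 0 < ε / 3 by positivity)
  obtain ⟨e, he, h⟩ := T.exists_convL1_right_norm_sub_lt_of_hasCompactSupport μ hg hgs hgi
    (show 0 < ε / 3 by positivity)
  refine ⟨e, ?_⟩
  have h1 : ‖T.convL1 μ (f - hgi.toL1 g) e‖ ≤ ‖f - hgi.toL1 g‖ :=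
    (T.norm_convL1_le μ _ _).trans (mul_le_of_le_one_right (norm_nonneg _) he)
  have h2 : T.convL1 μ f e - f = T.convL1 μ (f - hgi.toL1 g) e +
      (T.convL1 μ (hgi.toL1 g) e - hgi.toL1 g) - (f - hgi.toL1 g) := by
    rw [map_sub, _root_.sub_apply]; abel
  rw [h2]
  calc _ ≤ ‖T.convL1 μ (f - hgi.toL1 g) e‖ + ‖T.convL1 μ (hgi.toL1 g) e - hgi.toL1 g‖ +
        ‖f - hgi.toL1 g‖ := (norm_sub_le _ _).trans (by gcongr; exact norm_add_le _ _)
    _ < ε := by linarith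

section Algebra

variable {T μ}

lemma L1.integrable_toFun (Φ : T.L1 μ) : Integrable Φ.toFun μ :=
  MeasureTheory.L1.integrable_coeFn (Φ : Lp A 1 μ)

lemma L1.toL1_toFun (Φ : T.L1 μ) : (L1.integrable_toFun Φ).toL1 Φ.toFun = (Φ : Lp A 1 μ) :=
  Integrable.toL1_coeFn (Φ : Lp A 1 μ) _

lemma L1.integrable_conv (Φ Ψ : T.L1 μ) : Integrable (T.conv μ Φ.toFun Ψ.toFun) μ :=
  (MeasureTheory.L1.integrable_coeFn _).congr
    (T.conv_ae_eq Φ.integrable_toFun Ψ.integrable_toFun).2.symm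

/-- The default value in the definition of the product never occurs, so the algebra laws can be read
off from the bounded bilinear map `convL1`. -/
lemma L1.mul_eq (Φ Ψ : T.L1 μ) :
    Φ * Ψ = (T.convL1 μ (Φ : Lp A 1 μ) (Ψ : Lp A 1 μ) : Lp A 1 μ) := by
  have h : Φ * Ψ = ((L1.integrable_conv Φ Ψ).toL1 (T.conv μ Φ.toFun Ψ.toFun) : Lp A 1 μ) :=
    dif_pos (L1.integrable_conv Φ Ψ)
  rw [h]
  have h2 : (L1.integrable_conv Φ Ψ).toL1 (T.conv μ Φ.toFun Ψ.toFun) =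
      T.convL1 μ (Φ.integrable_toFun.toL1 Φ.toFun) (Ψ.integrable_toFun.toL1 Ψ.toFun) := by
    ext1
    exact (Integrable.coeFn_toL1 _).trans (T.conv_ae_eq Φ.integrable_toFun Ψ.integrable_toFun).2
  rw [h2, L1.toL1_toFun, L1.toL1_toFun]

noncomputable instance : NonUnitalNormedRing (T.L1 μ) :=
  { (inferInstance : NormedAddCommGroup (T.L1 μ)), (inferInstance : Mul (T.L1 μ)) with
    left_distrib := fun Φ Ψ Θ => by
      simp only [L1.mul_eq]
      exact (T.convL1 μ (Φ : Lp A 1 μ)).map_add _ _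
    right_distrib := fun Φ Ψ Θ => by
      simp only [L1.mul_eq]
      exact (T.convL1 μ).map_add₂ _ _ _
    zero_mul := fun Φ => by
      rw [L1.mul_eq]
      exact (T.convL1 μ).map_zero₂ _
    mul_zero := fun Φ => by
      rw [L1.mul_eq]
      exact (T.convL1 μ (Φ : Lp A 1 μ)).map_zero
    mul_assoc := fun Φ Ψ Θ => by
      exact (congrArg (· * Θ) (L1.mul_eq Φ Ψ)).trans ((L1.mul_eq _ _).trans
        ((T.convL1_assoc μ _ _ _).trans
          ((congrArg (Φ * ·) (L1.mul_eq Ψ Θ)).trans (L1.mul_eq _ _)).symm))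
    norm_mul_le := fun Φ Ψ => by
      rw [L1.mul_eq]
      exact T.norm_convL1_le μ _ _ }

instance : IsScalarTower ℂ (T.L1 μ) (T.L1 μ) where
  smul_assoc c Φ Ψ := by
    simp only [smul_eq_mul, L1.mul_eq]
    exact (T.convL1 μ).map_smul₂ c _ _

instance : SMulCommClass ℂ (T.L1 μ) (T.L1 μ) where
  smul_comm c Φ Ψ := by
    simp only [smul_eq_mul, L1.mul_eq]
    exact ((T.convL1 μ (Φ : Lp A 1 μ)).map_smul c _).symm

lemma L1.mul_mem_closure_span (Φ Ψ : T.L1 μ) : Φ * Ψ ∈ (Submodule.span ℂ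
    ((fun U : T.L1 μ ≃ₗᵢ[ℂ] T.L1 μ => U Ψ) '' isometricLeftMultipliers (T.L1 μ))).topologicalClosure := by
  rw [L1.mul_eq]
  refine Submodule.topologicalClosure_mono (Submodule.span_mono ?_)
    (T.convL1_mem_closure_span μ (Φ : Lp A 1 μ) (Ψ : Lp A 1 μ))
  rintro _ ⟨p, rfl⟩
  refine ⟨T.unitaryTranslate μ p.1 p.2, fun Θ Ξ => ?_, rfl⟩
  rw [L1.mul_eq, L1.mul_eq]
  exact T.unitaryTranslate_convL1 μ p.1 p.2 _ _

end Algebra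

end TwistedAction

/-! ### The equivalence for the twisted convolution algebra -/

theorem mainTheorem4 {G : Type u} {A : Type v} [Group G] [TopologicalSpace G]
    [IsTopologicalGroup G] [LocallyCompactSpace G] [T2Space G] [MeasurableSpace G] [BorelSpace G]
    [NonUnitalCStarAlgebra A] (T : TwistedAction G A)
    (μ : Measure G) [μ.IsHaarMeasure] [μ.Regular] :
    (∀ Φ Ψ : T.L1 μ,
        (∀ᵐ x ∂μ, Integrable (T.convIntegrand Φ.toFun Ψ.toFun x) μ) ∧
        Integrable (T.conv μ Φ.toFun Ψ.toFun) μ) ∧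
    List.TFAE
      [FiniteRangeHomsContinuous.{max u v, w} (T.L1 μ),
        FiniteDimDerivationsContinuous.{max u v, w} (T.L1 μ),
        CofiniteIdealsClosed (T.L1 μ),
        SquaresClosedCofinite (T.L1 μ)] := by
  refine ⟨fun Φ Ψ => ⟨(T.conv_ae_eq Φ.integrable_toFun Ψ.integrable_toFun).1,
    TwistedAction.L1.integrable_conv Φ Ψ⟩, ?_⟩
  tfae_have 1 → 3 := fun h => finiteRangeHoms_to_cofiniteIdealsClosed h
  tfae_have 3 → 1 := fun h => finiteRangeHomsContinuous_of_cofiniteIdealsClosed h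
  tfae_have 3 → 2 := fun h => finiteDimDerivationsContinuous_of_cofiniteIdealsClosed h
  tfae_have 2 → 4 := fun h => squaresClosedCofinite_of_finiteDimDerivationsContinuous
    (fun F ε hε => by
      obtain ⟨e, he⟩ := T.exists_convL1_left_norm_sub_lt μ F hε
      exact ⟨e, fun b hb => (congrArg (fun c : T.L1 μ => ‖c - b‖)
        (TwistedAction.L1.mul_eq e b)).trans_lt (he b hb)⟩)
    (fun b ε hε => by
      obtain ⟨e, he⟩ := T.exists_convL1_right_norm_sub_lt μ b hε
      exact ⟨e, (congrArg (fun c : T.L1 μ => ‖c - b‖)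
        (TwistedAction.L1.mul_eq b e)).trans_lt he⟩)
    TwistedAction.L1.mul_mem_closure_span h
  tfae_have 4 → 3 := fun h => cofiniteIdealsClosed_of_squaresClosedCofinite h
  tfae_finish
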